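/- Fix an integer $n\ge 1$ and write $[n]=\{1,\dots,n\}$. An affine permutation is a bijection $f:\mathbb Z\to\mathbb Z$ with $f(i+n)=f(i)+n$ for all $i$. Put $k(f)=\frac1n\sum_{i\in[n]}(f(i)-i)$ and let $\ell(f)$ be the number of pairs $(i,j)$ with $i\in[n]$, $i<j$ and $f(i)>f(j)$. For $n\ge2$ and $i\in[n]$ let $s_i$ be the affine permutation that swaps $i+dn$ and $i+1+dn$ for every $d\in\mathbb Z$ and fixes all other integers (for $n=1$ there are no $s_i$). Write $f\to f'$ if there is a finite, possibly empty, sequence $f=f_0,f_1,\dots,f_m=f'$ such that for each $j$ we have $f_j=s_{i}f_{j-1}s_{i}$ for some $i\in[n]$ and $\ell(f_j)\le\ell(f_{j-1})$. A set $C\subset\mathbb Z$ is $f$-closed if it is nonempty, $C+n=C$ and $f(C)=C$; a cycle of $f$ is a minimal $f$-closed set. For an $f$-closed set $C$ let $n_f(C)=\#(C\cap[n])$, let $r_C:C\to\mathbb Z$ be the order-preserving bijection sending $\min(C\cap[n])$ to $1$, and let $k_f(C)=k(r_C\circ f\circ r_C^{-1})$, where $r_C\circ f\circ r_C^{-1}$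 is an affine permutation with respect to the period $n_f(C)$. For $i\in\mathbb Z$ let $\nu_f(i)=k_f(C)/n_f(C)$, where $C$ is the cycle of $f$ containing $i$. Let $\mathcal L_n$ be the space of maps $x:\mathbb Z\to\mathbb R$ with $x_{i+n}=x_i+1$ for all $i$, modulo constant maps. A point $x\in\mathcal L_n$ is generic if $x_i\ne x_j$ for all $i\neq j$, and $\varepsilon$-straight (for $f$) if $|x_{f(i)}-(x_i+\nu_f(i))|\le\varepsilon$ for all $i\in\mathbb Z$. For generic $x$ let $g_x$ be the unique affine permutation with $k(g_x)=0$ and $g_x(i)<g_x(j)\iff x_i<x_j$ for all $i,j$. For generic $x,y$ write $\mathrm{Diag}_f(x)\to\mathrm{Diag}_f(y)$ if $g_xfg_x^{-1}\to g_yfg_y^{-1}$. **Proposition.** For every affine permutation $f$, every generic $x\in\mathcal L_n$ and every $\varepsilon>0$ there is a generic $\varepsilon$-straight point $y\in\mathcal L_n$ with $\mathrm{Diag}_f(x)\to\mathrm{Diag}_f(y)$. Moreover, $y$ can be chosen on the trajectory of $x$ under the linear ODE $\dot x_i=x_{f(i)}-x_i$ $(i\in\mathbb Z)$: there are a solution $x(t)$,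 $t\ge0$, of this ODE with $x(0)=x$ and a time $T\ge0$ with $x(T)=y$, such that $\mathrm{Diag}_f(x(s))\to\mathrm{Diag}_f(x(t))$ for all $0\le s\le t\le T$ for which $x(s)$ and $x(t)$ are generic. -/

import Mathlib

namespace ArrowDiagram

/-! ### Affine permutations -/

/-- The group of affine permutations: bijections `f : ℤ → ℤ` with `f (i + n) = f i + n`,
under composition. -/
def AffPerm (n : ℕ) : Subgroup (Equiv.Perm ℤ) where
  carrier := {f | ∀ i : ℤ, f (i + n) = f i + n}
  mul_mem' := by
    intro a b ha hb i
    simp only [Set.mem_ofPred_eq] at ha hb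
    simp [Equiv.Perm.mul_apply, hb, ha]
  one_mem' := by intro i; rfl
  inv_mem' := by
    intro a ha i
    simp only [Set.mem_ofPred_eq] at ha
    rw [Equiv.Perm.inv_eq_iff_eq, ha]
    congr 1
    exact (Equiv.apply_symm_apply a i).symm

/-- `k(f) = (1/n) ∑_{i ∈ [n]} (f(i) - i)`. -/
noncomputable def kNum {n : ℕ} (f : AffPerm n) : ℚ :=
  (∑ i ∈ Finset.Icc (1 : ℤ) n, ((f.1 i : ℚ) - (i : ℚ))) / n

/-- Inversions `(i, j)` of `f` with `i ∈ [n]`, i.e. representatives of the inversions modulo the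
shift `(i, j) ↦ (i + n, j + n)`. -/
def inversions {n : ℕ} (f : AffPerm n) : Set (ℤ × ℤ) :=
  {p | p.1 < p.2 ∧ f.1 p.2 < f.1 p.1 ∧ p.1 ∈ Set.Icc (1 : ℤ) n}

/-- The length `ℓ(f)`; see `inversions_finite`. -/
noncomputable def length {n : ℕ} (f : AffPerm n) : ℕ := (inversions f).ncard

/-- The underlying map of the simple reflection `s_i`: it sends `j ↦ j + 1` for `j ≡ i`,
`j ↦ j - 1` for `j ≡ i + 1`, and fixes all other `j` (congruences modulo `n`). -/
def simpleReflFun (n : ℕ) (i j : ℤ) : ℤ :=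
  if (n : ℤ) ∣ j - i then j + 1 else if (n : ℤ) ∣ j - (i + 1) then j - 1 else j

theorem simpleReflFun_involutive {n : ℕ} (hn : 2 ≤ n) (i : ℤ) :
    Function.Involutive (simpleReflFun n i) := by
  have h1 : ¬ (n : ℤ) ∣ 1 := by
    intro h
    have := Int.le_of_dvd one_pos h
    omega
  intro j
  unfold simpleReflFun
  by_cases h : (n : ℤ) ∣ j - i
  · have h2 : ¬ (n : ℤ) ∣ j + 1 - i := by
      intro h'
      apply h1
      have := dvd_sub h' h
      rwa [show j + 1 - i - (j - i) = 1 by ring] at this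
    simp [h, h2]
  · by_cases h' : (n : ℤ) ∣ j - (i + 1)
    · have h2 : (n : ℤ) ∣ j - 1 - i := by
        rwa [show j - 1 - i = j - (i + 1) by ring]
      simp [h, h', h2]
    · simp [h, h']

/-- The simple reflection `s_i` (it exists only for `n ≥ 2`). -/
def simpleRefl {n : ℕ} (hn : 2 ≤ n) (i : ℤ) : AffPerm n :=
  ⟨(simpleReflFun_involutive hn i).toPerm, by
    intro j
    have e1 : (n : ℤ) ∣ j + n - i ↔ (n : ℤ) ∣ j - i := by
      rw [show j + n - i = (j - i) + n by ring, dvd_add_self_right]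
    have e2 : (n : ℤ) ∣ j + n - (i + 1) ↔ (n : ℤ) ∣ j - (i + 1) := by
      rw [show j + n - (i + 1) = (j - (i + 1)) + n by ring, dvd_add_self_right]
    simp only [Function.Involutive.coe_toPerm, simpleReflFun, e1, e2]
    split_ifs <;> ring⟩

/-- One step: `f' = s_i f s_i` for some `i ∈ [n]`, with `ℓ(f') ≤ ℓ(f)`. For `n = 1` there are no
simple reflections, hence no steps. -/
def ConjStep {n : ℕ} (f f' : AffPerm n) : Prop :=
  ∃ (hn : 2 ≤ n) (i : ℤ), i ∈ Set.Icc (1 : ℤ) n ∧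
    f' = simpleRefl hn i * f * simpleRefl hn i ∧ length f' ≤ length f

/-- The relation `f → f'`: a finite (possibly empty) sequence of steps. -/
def ConjTo {n : ℕ} : AffPerm n → AffPerm n → Prop := Relation.ReflTransGen ConjStep

/-! ### Finiteness of the length -/

theorem periodic_bounded {n : ℕ} [NeZero n] (h : ℤ → ℝ) (hp : ∀ i, h (i + n) = h i) :
    ∃ M : ℝ, ∀ i, |h i| ≤ M := by
  have hn : (0 : ℤ) < n := by exact_mod_cast Nat.pos_of_ne_zero (NeZero.ne n)
  have hper : Function.Periodic h (n : ℤ) := hp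
  refine ⟨∑ j ∈ Finset.Ico (0 : ℤ) n, |h j|, fun i => ?_⟩
  have e : h i = h (i % n) := by
    conv_lhs => rw [← Int.emod_add_mul_ediv i n]
    have := hper.int_mul (i / n) (i % n)
    rw [mul_comm]
    simpa using this
  rw [e]
  exact Finset.single_le_sum (f := fun j => |h j|) (fun j _ => abs_nonneg _)
    (Finset.mem_Ico.2 ⟨Int.emod_nonneg _ hn.ne', Int.emod_lt_of_pos _ hn⟩)

theorem inversions_finite {n : ℕ} [NeZero n] (f : AffPerm n) : (inversions f).Finite := by
  obtain ⟨M, hM⟩ := periodic_bounded (n := n) (fun i => (f.1 i : ℝ) - i) (by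
    intro i
    have := f.2 i
    simp only [this]
    push_cast
    ring)
  refine ((Set.finite_Icc (1 : ℤ) n).prod (Set.finite_Icc (1 : ℤ) ⌈(n : ℝ) + 2 * M⌉)).subset ?_
  rintro ⟨i, j⟩ ⟨h1, h2, h3⟩
  simp only [Set.mem_Icc] at h3
  refine ⟨h3, ?_, ?_⟩
  · simp only at h1 ⊢
    omega
  · have a := abs_le.1 (hM i)
    have b := abs_le.1 (hM j)
    have c : (f.1 j : ℝ) < f.1 i := by exact_mod_cast h2
    have d : (i : ℝ) ≤ n := by exact_mod_cast h3.2
    have : (j : ℝ) ≤ n + 2 * M := by linarith [a.2, b.1]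
    exact_mod_cast this.trans (Int.le_ceil _)

/-! ### Cycles and slopes -/

/-- `f`-closed sets: nonempty, `n`-periodic, and stable under `f` and `f⁻¹`. -/
structure IsFClosed {n : ℕ} (f : AffPerm n) (C : Set ℤ) : Prop where
  nonempty : C.Nonempty
  periodic : ∀ i : ℤ, i ∈ C ↔ i + n ∈ C
  closed : ∀ i : ℤ, i ∈ C ↔ f.1 i ∈ C

/-- `n_f(C) = #(C ∩ [n])`. -/
noncomputable def nNum (n : ℕ) (C : Set ℤ) : ℕ := (C ∩ Set.Icc (1 : ℤ) n).ncard

open Classical in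
/-- The counting function `r_C`: for `i ∈ C`, `i ≥ 1` the number of elements of `C` in `[1, i]`, and
for `i ∈ C`, `i ≤ 0` minus the number of elements of `C` in `[i + 1, 0]`. Restricted to a nonempty
periodic set `C`, it is the order-preserving bijection `C → ℤ` sending `min (C ∩ [n])` to `1`. -/
noncomputable def rank (C : Set ℤ) (i : ℤ) : ℤ :=
  (((Finset.Ioc 0 i).filter (· ∈ C)).card : ℤ) - (((Finset.Ioc i 0).filter (· ∈ C)).card : ℤ)

open Classical in
theorem rank_succ (C : Set ℤ) (i : ℤ) :
    rank C (i + 1) = rank C i + if i + 1 ∈ C then 1 else 0 := by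
  unfold rank
  rcases le_or_gt 0 i with h | h
  · have e1 : Finset.Ioc 0 (i + 1) = insert (i + 1) (Finset.Ioc 0 i) := by
      ext k; simp only [Finset.mem_Ioc, Finset.mem_insert]; omega
    have e2 : Finset.Ioc (i + 1) 0 = ∅ := Finset.Ioc_eq_empty (by omega)
    have e3 : Finset.Ioc i 0 = ∅ := Finset.Ioc_eq_empty (by omega)
    rw [e1, e2, e3, Finset.filter_insert]
    split_ifs with hc
    · rw [Finset.card_insert_of_notMem (by simp)]
      simp
    · simp
  · have e1 : Finset.Ioc i 0 = insert (i + 1) (Finset.Ioc (i + 1) 0) := by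
      ext k; simp only [Finset.mem_Ioc, Finset.mem_insert]; omega
    have e2 : Finset.Ioc 0 (i + 1) = ∅ := Finset.Ioc_eq_empty (by omega)
    have e3 : Finset.Ioc 0 i = ∅ := Finset.Ioc_eq_empty (by omega)
    rw [e1, e2, e3, Finset.filter_insert]
    split_ifs with hc
    · rw [Finset.card_insert_of_notMem (by simp)]
      push_cast
      simp
    · simp

theorem rank_add_period {n : ℕ} (C : Set ℤ) (hp : ∀ i : ℤ, i ∈ C ↔ i + n ∈ C) (i : ℤ) :
    rank C (i + n) = rank C i + nNum n C := by
  classical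
  have step : ∀ j : ℤ, rank C (j + 1 + n) - rank C (j + 1) = rank C (j + n) - rank C j := by
    intro j
    have a := rank_succ C j
    have b := rank_succ C (j + n)
    rw [show j + n + 1 = j + 1 + n by ring] at b
    have c := hp (j + 1)
    by_cases hc : j + 1 ∈ C
    · have hc' := c.1 hc
      simp only [hc, hc', if_true] at a b
      omega
    · have hc' : j + 1 + n ∉ C := fun h => hc (c.2 h)
      simp only [hc, hc', if_false] at a b
      omega
  have zero : rank C (0 + n) - rank C 0 = nNum n C := by
    have e : ((Finset.Ioc (0 : ℤ) n).filter (· ∈ C) : Set ℤ) = C ∩ Set.Icc (1 : ℤ) n := by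
      ext k
      simp only [Finset.coe_filter, Finset.mem_Ioc, Set.mem_ofPred_eq, Set.mem_inter_iff,
        Set.mem_Icc]
      constructor
      · rintro ⟨⟨h1, h2⟩, h3⟩
        exact ⟨h3, by omega, h2⟩
      · rintro ⟨h3, h1, h2⟩
        exact ⟨⟨by omega, h2⟩, h3⟩
    unfold nNum
    rw [← e, Set.ncard_coe_finset]
    simp [rank]
  have all : ∀ j : ℤ, rank C (j + n) - rank C j = nNum n C := by
    intro j
    induction j using Int.induction_on with
    | zero => exact zero
    | succ k ih => rw [step]; exact ih
    | pred k ih =>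
      have := step (-(k : ℤ) - 1)
      rw [show -(k : ℤ) - 1 + 1 = -k by ring] at this
      omega
  have := all i
  omega

theorem rank_mono (C : Set ℤ) : Monotone (rank C) := by
  classical
  apply monotone_int_of_le_succ
  intro i
  rw [rank_succ]
  split_ifs <;> omega

theorem rank_lt (C : Set ℤ) {i j : ℤ} (hj : j ∈ C) (h : i < j) : rank C i < rank C j := by
  classical
  have a := rank_succ C (j - 1)
  simp only [sub_add_cancel, hj, if_true] at a
  have b := rank_mono C (show i ≤ j - 1 by omega)
  omega

theorem nNum_pos {n : ℕ} [NeZero n] (C : Set ℤ) (hne : C.Nonempty)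
    (hp : ∀ i : ℤ, i ∈ C ↔ i + n ∈ C) : 0 < nNum n C := by
  obtain ⟨c, hc⟩ := hne
  have hn : (0 : ℤ) < n := by exact_mod_cast Nat.pos_of_ne_zero (NeZero.ne n)
  have a := rank_lt C ((hp c).1 hc) (show c < c + n by omega)
  rw [rank_add_period C hp] at a
  omega

theorem rank_bijective {n : ℕ} [NeZero n] (C : Set ℤ) (hne : C.Nonempty)
    (hp : ∀ i : ℤ, i ∈ C ↔ i + n ∈ C) :
    Function.Bijective (fun i : C => rank C i) := by
  classical
  constructor
  · rintro ⟨i, hi⟩ ⟨j, hj⟩ h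
    rcases lt_trichotomy i j with h' | h' | h'
    · exact absurd h (rank_lt C hj h').ne
    · exact Subtype.ext h'
    · exact absurd h (rank_lt C hi h').ne'
  · intro m
    have hpos := nNum_pos C hne hp
    have mul : ∀ k : ℕ, rank C (k * n) = k * nNum n C ∧ rank C (-(k * n)) = -(k * nNum n C) := by
      intro k
      induction k with
      | zero => simp [rank]
      | succ k ih =>
        constructor
        · have := rank_add_period C hp (k * n)
          push_cast
          rw [show ((k : ℤ) + 1) * n = k * n + n by ring, this, ih.1]
          ring
        · have := rank_add_period C hp (-((k + 1) * n))
          push_cast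
          rw [show -(((k : ℤ) + 1) * n) + n = -(k * n) by ring, ih.2] at this
          linarith
    have hle : ∀ k : ℕ, (k : ℤ) ≤ k * nNum n C := by
      intro k
      have : (1 : ℤ) ≤ nNum n C := by exact_mod_cast hpos
      nlinarith
    obtain ⟨i, hi, hmin⟩ := Int.exists_least_of_bdd (P := fun i => m ≤ rank C i)
      ⟨-((m.natAbs + 1 : ℕ) * n), by
        intro z hz
        by_contra hlt
        have a := rank_mono C (le_of_not_ge hlt)
        rw [(mul _).2] at a
        have b := hle (m.natAbs + 1)
        push_cast at a b
        have c := neg_abs_le m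
        omega⟩
      ⟨(m.natAbs : ℕ) * n, by
        rw [(mul _).1]
        have b := hle m.natAbs
        omega⟩
    have a := rank_succ C (i - 1)
    rw [sub_add_cancel] at a
    have b : ¬ m ≤ rank C (i - 1) := fun h => by
      have := hmin _ h
      omega
    by_cases hc : i ∈ C
    · refine ⟨⟨i, hc⟩, ?_⟩
      simp only [hc, if_true] at a
      simp only
      omega
    · simp only [hc, if_false] at a
      omega

/-- The bijection `r_C : C → ℤ`. -/
noncomputable def rankEquiv {n : ℕ} [NeZero n] {f : AffPerm n} {C : Set ℤ} (hC : IsFClosed f C) :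
    C ≃ ℤ :=
  Equiv.ofBijective _ (rank_bijective C hC.nonempty hC.periodic)

/-- The restriction `f|_C = r_C ∘ f ∘ r_C⁻¹`, an affine permutation of period `n_f(C)`. -/
noncomputable def restrict {n : ℕ} [NeZero n] (f : AffPerm n) {C : Set ℤ} (hC : IsFClosed f C) :
    AffPerm (nNum n C) :=
  ⟨(rankEquiv hC).permCongr (Equiv.Perm.subtypePerm f.1 (fun i => (hC.closed i).symm)), by
    intro m
    obtain ⟨⟨i, hi⟩, rfl⟩ := (rankEquiv hC).surjective m
    have e : rankEquiv hC ⟨i, hi⟩ + nNum n C = rankEquiv hC ⟨i + n, (hC.periodic i).1 hi⟩ :=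
      (rank_add_period C hC.periodic i).symm
    rw [e]
    simp only [Equiv.permCongr_apply, Equiv.symm_apply_apply]
    change rank C (f.1 (i + n)) = rank C (f.1 i) + _
    rw [f.2 i, rank_add_period C hC.periodic]⟩

/-- The slope `k_f(C) / n_f(C)` of an `f`-closed set, where `k_f(C) = k(f|_C)`. -/
noncomputable def slopeOfSet {n : ℕ} [NeZero n] (f : AffPerm n) {C : Set ℤ} (hC : IsFClosed f C) :
    ℚ :=
  kNum (restrict f hC) / nNum n C

/-- A cycle of `f` is a minimal `f`-closed set. -/
def IsCycle {n : ℕ} (f : AffPerm n) (C : Set ℤ) : Prop := Minimal (IsFClosed f) C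

/-- The cycle of `f` containing `i`, as the smallest `f`-closed set containing `i`; see
`isCycle_cycleOf` and `IsCycle.eq_cycleOf`. -/
def cycleOf {n : ℕ} (f : AffPerm n) (i : ℤ) : Set ℤ := ⋂₀ {C | IsFClosed f C ∧ i ∈ C}

theorem mem_cycleOf {n : ℕ} (f : AffPerm n) (i : ℤ) : i ∈ cycleOf f i := fun _ hC => hC.2

theorem isFClosed_cycleOf {n : ℕ} (f : AffPerm n) (i : ℤ) : IsFClosed f (cycleOf f i) where
  nonempty := ⟨i, mem_cycleOf f i⟩
  periodic := fun j => ⟨fun h C hC => (hC.1.periodic j).1 (h C hC),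
    fun h C hC => (hC.1.periodic j).2 (h C hC)⟩
  closed := fun j => ⟨fun h C hC => (hC.1.closed j).1 (h C hC),
    fun h C hC => (hC.1.closed j).2 (h C hC)⟩

theorem isCycle_cycleOf {n : ℕ} (f : AffPerm n) (i : ℤ) : IsCycle f (cycleOf f i) := by
  refine ⟨isFClosed_cycleOf f i, fun D hD hDC => ?_⟩
  by_cases hi : i ∈ D
  · exact fun j hj => hj D ⟨hD, hi⟩
  · exfalso
    have h := isFClosed_cycleOf f i
    have : IsFClosed f (cycleOf f i \ D) :=
      ⟨⟨i, mem_cycleOf f i, hi⟩,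
        fun j => and_congr (h.periodic j) (not_congr (hD.periodic j)),
        fun j => and_congr (h.closed j) (not_congr (hD.closed j))⟩
    obtain ⟨d, hd⟩ := hD.nonempty
    exact (hDC hd _ ⟨this, mem_cycleOf f i, hi⟩).2 hd

theorem IsCycle.eq_cycleOf {n : ℕ} {f : AffPerm n} {C : Set ℤ} (hC : IsCycle f C) {i : ℤ}
    (hi : i ∈ C) : C = cycleOf f i :=
  Set.Subset.antisymm (hC.2 (isFClosed_cycleOf f i) (fun _ hj => hj C ⟨hC.1, hi⟩))
    (fun _ hj => hj C ⟨hC.1, hi⟩)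

/-- The slope `ν_f(i)` of the cycle of `f` containing `i`. -/
noncomputable def slope {n : ℕ} [NeZero n] (f : AffPerm n) (i : ℤ) : ℚ :=
  slopeOfSet f (isFClosed_cycleOf f i)

/-! ### Point configurations -/

/-- Maps `x : ℤ → ℝ` with `x (i + n) = x i + 1`. -/
structure Config (n : ℕ) where
  pos : ℤ → ℝ
  add_period : ∀ i : ℤ, pos (i + n) = pos i + 1

/-- Two maps are identified if they differ by a constant. -/
instance configSetoid (n : ℕ) : Setoid (Config n) where
  r x y := ∃ c : ℝ, ∀ i, y.pos i = x.pos i + c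
  iseqv :=
    { refl := fun _ => ⟨0, fun _ => by simp⟩
      symm := fun ⟨c, h⟩ => ⟨-c, fun i => by rw [h]; ring⟩
      trans := fun ⟨c, h⟩ ⟨d, h'⟩ => ⟨c + d, fun i => by rw [h', h]; ring⟩ }

/-- The space `𝓛_n` of maps `x : ℤ → ℝ` with `x (i + n) = x i + 1`, modulo constant maps. -/
def LSpace (n : ℕ) : Type := Quotient (configSetoid n)

/-- The class in `𝓛_n` of a map. -/
def Config.toL {n : ℕ} (x : Config n) : LSpace n := Quotient.mk (configSetoid n) x

/-- The difference `x(j) - x(i)`, which is well defined on `𝓛_n`. -/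
def LSpace.diff {n : ℕ} (x : LSpace n) (i j : ℤ) : ℝ :=
  Quotient.lift (fun z : Config n => z.pos j - z.pos i)
    (by rintro a b ⟨c, h⟩; simp only [h]; ring) x

/-- `x` is generic if `x(i) ≠ x(j)` for `i ≠ j`. -/
def LSpace.IsGeneric {n : ℕ} (x : LSpace n) : Prop := ∀ i j : ℤ, i ≠ j → x.diff i j ≠ 0

/-- `x` is `ε`-straight for `f`: `|x(f(i)) - (x(i) + ν_f(i))| ≤ ε` for all `i`. -/
def LSpace.IsStraight {n : ℕ} [NeZero n] (f : AffPerm n) (ε : ℝ) (x : LSpace n) : Prop :=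
  ∀ i : ℤ, |x.diff i (f.1 i) - (slope f i : ℝ)| ≤ ε

theorem Config.finite_Icc {n : ℕ} [NeZero n] (x : Config n) :
    ∀ c : ℝ, {k : ℤ | 1 ≤ k ∧ x.pos k ≤ c}.Finite ∧ {k : ℤ | k ≤ 0 ∧ c < x.pos k}.Finite := by
  have hn : (0 : ℝ) < n := by exact_mod_cast Nat.pos_of_ne_zero (NeZero.ne n)
  obtain ⟨M, hM⟩ := periodic_bounded (n := n) (fun i => x.pos i - i / n) (by
    intro i
    simp only [x.add_period]
    push_cast
    field_simp
    ring)
  intro c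
  constructor
  · refine (Set.finite_Icc (1 : ℤ) ⌈n * (c + M)⌉).subset ?_
    rintro k ⟨h1, h2⟩
    refine ⟨h1, ?_⟩
    have a := (abs_le.1 (hM k)).1
    have : (k : ℝ) / n ≤ c + M := by linarith
    rw [div_le_iff₀ hn, mul_comm] at this
    exact_mod_cast this.trans (Int.le_ceil _)
  · refine (Set.finite_Icc ⌊n * (c - M)⌋ (0 : ℤ)).subset ?_
    rintro k ⟨h1, h2⟩
    refine ⟨?_, h1⟩
    have a := (abs_le.1 (hM k)).2
    have : c - M ≤ (k : ℝ) / n := by linarith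
    rw [le_div_iff₀ hn, mul_comm] at this
    exact_mod_cast (Int.floor_le _).trans this

/-- A bijection from an injective map commuting with the shift by `n`. -/
theorem bijective_of_shift {n : ℕ} [NeZero n] (r : ℤ → ℤ) (hr : Function.Injective r)
    (hs : ∀ i, r (i + n) = r i + n) : Function.Bijective r := by
  have hmul : ∀ (k : ℤ) i, r (i + k * n) = r i + k * n := by
    intro k
    induction k using Int.induction_on with
    | zero => simp
    | succ k ih =>
      intro i
      rw [show i + ((k : ℤ) + 1) * n = (i + k * n) + n by ring, hs, ih]
      ring
    | pred k ih =>
      intro i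
      have := hs (i + (-(k : ℤ) - 1) * n)
      rw [show i + (-(k : ℤ) - 1) * n + n = i + -k * n by ring, ih] at this
      linarith
  refine ⟨hr, fun m => ?_⟩
  have hinj : Function.Injective (fun a : ZMod n => ((r (a.val : ℤ) : ℤ) : ZMod n)) := by
    intro a b hab
    obtain ⟨k, hk⟩ := (ZMod.intCast_eq_intCast_iff_dvd_sub _ _ n).1 hab
    have : r (b.val : ℤ) = r ((a.val : ℤ) + k * n) := by rw [hmul]; linarith
    have h2 := congrArg (fun z : ℤ => (z : ZMod n)) (hr this)
    simpa using h2.symm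
  obtain ⟨a, ha⟩ := (Finite.injective_iff_surjective.1 hinj) (m : ZMod n)
  obtain ⟨k, hk⟩ := (ZMod.intCast_eq_intCast_iff_dvd_sub _ _ n).1 ha
  exact ⟨(a.val : ℤ) + k * n, by rw [hmul]; linarith⟩

/-- The number `k(f)` is an integer. -/
theorem exists_kNum_eq {n : ℕ} [NeZero n] (f : AffPerm n) : ∃ k : ℤ, kNum f = k := by
  have hn : (n : ℚ) ≠ 0 := by exact_mod_cast NeZero.ne n
  have hmul : ∀ (k : ℤ) i, f.1 (i + k * n) = f.1 i + k * n := by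
    have hs := f.2
    intro k
    induction k using Int.induction_on with
    | zero => simp
    | succ k ih =>
      intro i
      rw [show i + ((k : ℤ) + 1) * n = (i + k * n) + n by ring, hs, ih]
      ring
    | pred k ih =>
      intro i
      have := hs (i + (-(k : ℤ) - 1) * n)
      rw [show i + (-(k : ℤ) - 1) * n + n = i + -k * n by ring, ih] at this
      linarith
  have hinj : Function.Injective (fun a : ZMod n => ((f.1 (a.val : ℤ) : ℤ) : ZMod n)) := by
    intro a b hab
    obtain ⟨k, hk⟩ := (ZMod.intCast_eq_intCast_iff_dvd_sub _ _ n).1 hab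
    have : f.1 (b.val : ℤ) = f.1 ((a.val : ℤ) + k * n) := by rw [hmul]; linarith
    have h2 := congrArg (fun z : ℤ => (z : ZMod n)) (f.1.injective this)
    simpa using h2.symm
  have hbij := Finite.injective_iff_bijective.1 hinj
  have hsum : ∀ g : ZMod n → ZMod n,
      ∑ i ∈ Finset.Icc (1 : ℤ) n, g (i : ZMod n) = ∑ a : ZMod n, g a := by
    intro g
    refine Finset.sum_bij' (fun i _ => (i : ZMod n)) (fun a _ => ((a - 1).val : ℤ) + 1) ?_ ?_ ?_ ?_ ?_
    · simp
    · intro a _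
      have := ZMod.val_lt (a - 1)
      simp only [Finset.mem_Icc]
      omega
    · intro i hi
      simp only [Finset.mem_Icc] at hi
      have e : ((i : ZMod n) - 1) = ((i - 1 : ℤ) : ZMod n) := by push_cast; ring
      rw [e, ZMod.val_intCast, Int.emod_eq_of_lt (by omega) (by omega)]
      ring
    · intro a _
      simp
    · simp
  have hdvd : (n : ℤ) ∣ ∑ i ∈ Finset.Icc (1 : ℤ) n, (f.1 i - i) := by
    rw [← ZMod.intCast_zmod_eq_zero_iff_dvd]
    push_cast
    rw [Finset.sum_sub_distrib, sub_eq_zero]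
    have e : ∀ i : ℤ, ((f.1 i : ℤ) : ZMod n) = ((f.1 ((i : ZMod n).val : ℤ) : ℤ) : ZMod n) := by
      intro i
      rw [ZMod.val_intCast]
      conv_lhs => rw [← Int.emod_add_mul_ediv i n, mul_comm, hmul]
      simp
    rw [Finset.sum_congr rfl (fun i _ => e i),
      hsum (fun a => ((f.1 (a.val : ℤ) : ℤ) : ZMod n)), hsum (fun a => a)]
    exact hbij.sum_comp (fun a => a)
  obtain ⟨k, hk⟩ := hdvd
  refine ⟨k, ?_⟩
  unfold kNum
  rw [div_eq_iff hn]
  have := congrArg (fun z : ℤ => (z : ℚ)) hk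
  push_cast at this
  rw [this]
  ring

/-- For generic `x` there is an affine permutation `g` with `k(g) = 0` whose values are ordered as
the points of `x`. -/
theorem exists_standardization {n : ℕ} [NeZero n] (x : LSpace n) (hx : x.IsGeneric) :
    ∃ g : AffPerm n, kNum g = 0 ∧ ∀ i j : ℤ, g.1 i < g.1 j ↔ 0 < x.diff i j := by
  have hn : (n : ℚ) ≠ 0 := by exact_mod_cast NeZero.ne n
  induction x using Quotient.inductionOn with
  | h x =>
  have hinj : ∀ i j, i ≠ j → x.pos j - x.pos i ≠ 0 := hx
  change ∃ g : AffPerm n, kNum g = 0 ∧ ∀ i j : ℤ, g.1 i < g.1 j ↔ 0 < x.pos j - x.pos i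
  let A : ℤ → Set ℤ := fun i => {k : ℤ | 1 ≤ k ∧ x.pos k ≤ x.pos i}
  let B : ℤ → Set ℤ := fun i => {k : ℤ | k ≤ 0 ∧ x.pos i < x.pos k}
  have hA : ∀ i, (A i).Finite := fun i => (x.finite_Icc (x.pos i)).1
  have hB : ∀ i, (B i).Finite := fun i => (x.finite_Icc (x.pos i)).2
  let r : ℤ → ℤ := fun i => ((A i).ncard : ℤ) - (B i).ncard
  have hlt : ∀ i j, x.pos i < x.pos j → r i < r j := by
    intro i j h
    have a : A i ⊆ A j := fun k hk => ⟨hk.1, hk.2.trans h.le⟩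
    have b : B j ⊆ B i := fun k hk => ⟨hk.1, h.trans hk.2⟩
    have a' := Set.ncard_le_ncard a (hA j)
    have b' := Set.ncard_le_ncard b (hB i)
    simp only [r]
    rcases le_or_gt 1 j with hj | hj
    · have : A i ⊂ A j := ⟨a, fun h' => absurd (h' (show j ∈ A j from ⟨hj, le_rfl⟩)).2 (not_le.2 h)⟩
      have := Set.ncard_lt_ncard this (hA j)
      omega
    · have : B j ⊂ B i :=
        ⟨b, fun h' => lt_irrefl _ (h' (show j ∈ B i from ⟨by omega, h⟩)).2⟩
      have := Set.ncard_lt_ncard this (hB i)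
      omega
  have hrinj : Function.Injective r := by
    intro i j h
    by_contra hne
    rcases lt_or_gt_of_ne (sub_ne_zero.1 (hinj i j hne)) with h' | h'
    · exact absurd h (hlt _ _ h').ne'
    · exact absurd h (hlt _ _ h').ne
  have hback : ∀ k : ℤ, x.pos k = x.pos (k - n) + 1 := by
    intro k
    have := x.add_period (k - n)
    rwa [sub_add_cancel] at this
  have hshift : ∀ i, r (i + n) = r i + n := by
    intro i
    let S : Set ℤ := {k | 1 - (n : ℤ) ≤ k ∧ k ≤ 0 ∧ x.pos k ≤ x.pos i}
    let T : Set ℤ := {k | 1 - (n : ℤ) ≤ k ∧ k ≤ 0 ∧ x.pos i < x.pos k}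
    let B' : Set ℤ := {k | k ≤ -(n : ℤ) ∧ x.pos i < x.pos k}
    have hIcc : (Set.Icc (1 - (n : ℤ)) 0).Finite := Set.finite_Icc _ _
    have hS : S.Finite := hIcc.subset fun k hk => ⟨hk.1, hk.2.1⟩
    have hT : T.Finite := hIcc.subset fun k hk => ⟨hk.1, hk.2.1⟩
    have hB' : B'.Finite := (hB i).subset fun k hk => ⟨by have := hk.1; omega, hk.2⟩
    have hinjn : Function.Injective (fun k : ℤ => k + n) := add_left_injective _
    have e1 : A (i + n) = (fun k : ℤ => k + n) '' (A i ∪ S) := by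
      ext k
      simp only [A, S, Set.mem_ofPred_eq, Set.mem_image, Set.mem_union, x.add_period]
      constructor
      · rintro ⟨h1, h2⟩
        rw [hback k] at h2
        refine ⟨k - n, ?_, by ring⟩
        rcases le_or_gt 1 (k - n) with h | h
        · exact Or.inl ⟨h, by linarith⟩
        · exact Or.inr ⟨by omega, by omega, by linarith⟩
      · rintro ⟨m, h | h, rfl⟩
        · exact ⟨by omega, by rw [x.add_period]; linarith [h.2]⟩
        · exact ⟨by omega, by rw [x.add_period]; linarith [h.2.2]⟩
    have e2 : B (i + n) = (fun k : ℤ => k + n) '' B' := by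
      ext k
      simp only [B, B', Set.mem_ofPred_eq, Set.mem_image, x.add_period]
      constructor
      · rintro ⟨h1, h2⟩
        rw [hback k] at h2
        exact ⟨k - n, ⟨by omega, by linarith⟩, by ring⟩
      · rintro ⟨m, h, rfl⟩
        exact ⟨by omega, by rw [x.add_period]; linarith [h.2]⟩
    have e3 : B i = B' ∪ T := by
      ext k
      simp only [B, B', T, Set.mem_ofPred_eq, Set.mem_union]
      constructor
      · rintro ⟨h1, h2⟩
        rcases le_or_gt k (-(n : ℤ)) with h | h
        · exact Or.inl ⟨h, h2⟩
        · exact Or.inr ⟨by omega, h1, h2⟩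
      · rintro (h | h)
        · exact ⟨by omega, h.2⟩
        · exact ⟨h.2.1, h.2.2⟩
    have e4 : Set.Icc (1 - (n : ℤ)) 0 = S ∪ T := by
      ext k
      simp only [S, T, Set.mem_ofPred_eq, Set.mem_union, Set.mem_Icc]
      constructor
      · rintro ⟨h1, h2⟩
        rcases le_or_gt (x.pos k) (x.pos i) with h | h
        · exact Or.inl ⟨h1, h2, h⟩
        · exact Or.inr ⟨h1, h2, h⟩
      · rintro (h | h)
        · exact ⟨h.1, h.2.1⟩
        · exact ⟨h.1, h.2.1⟩
    have d1 : Disjoint (A i) S :=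
      Set.disjoint_left.2 fun k h h' => by have := h.1; have := h'.2.1; omega
    have d3 : Disjoint B' T :=
      Set.disjoint_left.2 fun k h h' => by have := h.1; have := h'.1; omega
    have d4 : Disjoint S T :=
      Set.disjoint_left.2 fun k h h' => absurd h.2.2 (not_le.2 h'.2.2)
    have c1 := congrArg Set.ncard e1
    rw [Set.ncard_image_of_injective _ hinjn, Set.ncard_union_eq d1 (hA i) hS] at c1
    have c2 := congrArg Set.ncard e2
    rw [Set.ncard_image_of_injective _ hinjn] at c2
    have c3 := congrArg Set.ncard e3
    rw [Set.ncard_union_eq d3 hB' hT] at c3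
    have c4 := congrArg Set.ncard e4
    rw [Set.ncard_union_eq d4 hS hT, ← Finset.coe_Icc, Set.ncard_coe_finset, Int.card_Icc] at c4
    simp only [r]
    omega
  let g₀ : AffPerm n := ⟨Equiv.ofBijective r (bijective_of_shift r hrinj hshift), hshift⟩
  obtain ⟨k, hk⟩ := exists_kNum_eq g₀
  refine ⟨⟨g₀.1.trans (Equiv.subRight k), fun i => ?_⟩, ?_, fun i j => ?_⟩
  · change g₀.1 (i + n) - k = g₀.1 i - k + n
    rw [g₀.2 i]
    ring
  · unfold kNum at hk ⊢
    rw [div_eq_iff hn] at hk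
    rw [div_eq_iff hn, zero_mul]
    change ∑ i ∈ Finset.Icc (1 : ℤ) n, (((g₀.1 i - k : ℤ) : ℚ) - i) = 0
    have : ∀ i : ℤ, (((g₀.1 i - k : ℤ) : ℚ) - i) = ((g₀.1 i : ℚ) - i) - k := by
      intro i; push_cast; ring
    rw [Finset.sum_congr rfl (fun i _ => this i), Finset.sum_sub_distrib, hk]
    simp
    ring
  · change r i - k < r j - k ↔ _
    rw [sub_lt_sub_iff_right, sub_pos]
    refine ⟨fun h => ?_, hlt i j⟩
    by_contra h'
    rcases (not_lt.1 h').lt_or_eq with h'' | h''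
    · exact absurd (hlt _ _ h'') (not_lt.2 h.le)
    · have : j = i := by
        by_contra hne
        exact hinj j i hne (by rw [h'']; ring)
      subst this
      exact lt_irrefl _ h

/-- The affine permutation `g_x` of a generic `x`: the one with `k(g_x) = 0` and
`g_x(i) < g_x(j) ↔ x(i) < x(j)`. It is unique; see `eq_standardization`. -/
noncomputable def standardization {n : ℕ} [NeZero n] (x : LSpace n) (hx : x.IsGeneric) :
    AffPerm n :=
  (exists_standardization x hx).choose

theorem standardization_spec {n : ℕ} [NeZero n] (x : LSpace n) (hx : x.IsGeneric) :
    kNum (standardization x hx) = 0 ∧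
      ∀ i j : ℤ, (standardization x hx).1 i < (standardization x hx).1 j ↔ 0 < x.diff i j :=
  (exists_standardization x hx).choose_spec

theorem eq_standardization {n : ℕ} [NeZero n] (x : LSpace n) (hx : x.IsGeneric) (g : AffPerm n)
    (h0 : kNum g = 0) (hg : ∀ i j : ℤ, g.1 i < g.1 j ↔ 0 < x.diff i j) :
    g = standardization x hx := by
  have hn : (n : ℚ) ≠ 0 := by exact_mod_cast NeZero.ne n
  obtain ⟨h0', hg'⟩ := standardization_spec x hx
  set g' := standardization x hx
  have hm : ∀ a b : ℤ, a < b → g.1 (g'.1.symm a) < g.1 (g'.1.symm b) := by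
    intro a b hab
    rw [hg, ← hg']
    simpa using hab
  have hm' : ∀ a b : ℤ, a < b → g'.1 (g.1.symm a) < g'.1 (g.1.symm b) := by
    intro a b hab
    rw [hg', ← hg]
    simpa using hab
  let u : ℤ → ℤ := fun a => g.1 (g'.1.symm a)
  have hu : ∀ a, u (a + 1) = u a + 1 := by
    intro a
    have h1 : u a < u (a + 1) := hm _ _ (by omega)
    by_contra hne
    have h2 := hm' (u a) (u a + 1) (by omega)
    have h3 := hm' (u a + 1) (u (a + 1)) (by omega)
    simp only [u, Equiv.symm_apply_apply, Equiv.apply_symm_apply] at h2 h3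
    omega
  have hconst : ∀ a, u a = a + u 0 := by
    intro a
    induction a using Int.induction_on with
    | zero => simp
    | succ k ih => rw [hu, ih]; ring
    | pred k ih =>
      have := hu (-(k : ℤ) - 1)
      rw [sub_add_cancel, ih] at this
      linarith
  have hgg : ∀ i, g.1 i = g'.1 i + u 0 := by
    intro i
    rw [← hconst]
    simp [u]
  have hz : u 0 = 0 := by
    unfold kNum at h0 h0'
    rw [div_eq_iff hn, zero_mul] at h0 h0'
    have : ∀ i : ℤ, ((g.1 i : ℚ) - i) = ((g'.1 i : ℚ) - i) + u 0 := by
      intro i; rw [hgg]; push_cast; ring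
    rw [Finset.sum_congr rfl (fun i _ => this i), Finset.sum_add_distrib, h0'] at h0
    simp only [Finset.sum_const, Int.card_Icc, nsmul_eq_mul, zero_add] at h0
    rcases mul_eq_zero.1 h0 with h | h
    · simp at h
      exact absurd h (by exact_mod_cast NeZero.ne n)
    · exact_mod_cast h
  exact Subtype.ext (Equiv.ext fun i => by rw [hgg, hz, add_zero])

/-- The affine permutation `g_x f g_x⁻¹` whose standard arrow diagram is topologically equivalent
to the arrow diagram `Diag_f(x)`. -/
noncomputable def diagPerm {n : ℕ} [NeZero n] (f : AffPerm n) (x : LSpace n) (hx : x.IsGeneric) :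
    AffPerm n :=
  standardization x hx * f * (standardization x hx)⁻¹

/-- The relation `Diag_f(x) → Diag_f(y)` for generic `x` and `y`. -/
def DiagTo {n : ℕ} [NeZero n] (f : AffPerm n) (x : LSpace n) (hx : x.IsGeneric)
    (y : LSpace n) (hy : y.IsGeneric) : Prop :=
  ConjTo (diagPerm f x hx) (diagPerm f y hy)

/-- `X(t)`, `t ≥ 0`, is a solution of the linear system `ẋ_i = x_{f(i)} - x_i`, `i ∈ ℤ`. (One-sided
derivative at `t = 0`.) -/
def IsFlowLine {n : ℕ} (f : AffPerm n) (X : ℝ → Config n) : Prop :=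
  ∀ i : ℤ, ∀ t : ℝ, 0 ≤ t →
    HasDerivWithinAt (fun s => (X s).pos i) ((X t).pos (f.1 i) - (X t).pos i) (Set.Ici 0) t

end ArrowDiagram

open ArrowDiagram

namespace ArrowDiagram

/-! ### Sums over a period -/

/-! Let the points move by the flow. For a pair `i`, `j` put `d = x_i - x_j` and `df = x_{f(i)} -
x_{f(j)}`; then `(e^t d)' = e^t df`. If `d` changes sign from negative to positive, `df` must be
positive on both sides of the crossing, so `f` maps the crossing pair to a pair that is in the new
order before and after (`pos_of_crossing`).

Combinatorially, let `w = g_y g_x⁻¹` and `h = g_x f g_x⁻¹`. Every inversion of `w` is then an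
inversion of `h` whose image under `h` is not inverted by `w`. A descent `s_a` of `w` is thus a
descent of `h`, conjugation by `s_a` does not increase `ℓ(h)`, and the condition is inherited by `w
s_a` and `s_a h s_a`. Induction on `ℓ(w)` yields `h → w h w⁻¹` (`conjTo_conj`). As `w` is arbitrary,
many pairs may collide at the same moment. Analyticity makes the collision times in a bounded
interval finite in number (`collisions_finite`), so a trajectory splits into pieces with at most one
collision time each (`diagTo_of_flow`).

For straightness, the energy `∑ (x_{f(i)} - x_i)²` over a period decreases at the rate `∑
((x_{f(f(i))} - x_{f(i)}) - (x_{f(i)} - x_i))²`, which therefore becomes arbitrarily small at some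
time (`exists_dissipation_lt`). The velocity is then almost constant along each orbit of `f`, and
its average over a closed orbit is the slope (`abs_sub_slope_le`). Smallness is an open condition in
time, so a generic time nearby serves as well. -/

theorem affPerm_apply_add_mul {n : ℕ} (f : AffPerm n) (k i : ℤ) :
    f.1 (i + k * n) = f.1 i + k * n := by
  induction k using Int.induction_on with
  | zero => simp
  | succ k ih =>
    rw [show i + ((k : ℤ) + 1) * n = (i + k * n) + n by ring, f.2, ih]
    ring
  | pred k ih =>
    have := f.2 (i + (-(k : ℤ) - 1) * n)
    rw [show i + (-(k : ℤ) - 1) * n + n = i + -k * n by ring, ih] at this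
    linarith

theorem apply_add_mul_of_periodic {n : ℕ} {M : Type*} {φ : ℤ → M} (hφ : ∀ i, φ (i + n) = φ i)
    (k i : ℤ) : φ (i + k * n) = φ i := by
  have h : Function.Periodic φ (n : ℤ) := hφ
  simpa using h.int_mul k i

/-- The representative in `[n]` of an integer modulo `n`. -/
def redMod (n : ℕ) (i : ℤ) : ℤ := (i - 1) % n + 1

theorem redMod_mem (n : ℕ) [NeZero n] (i : ℤ) : redMod n i ∈ Finset.Icc (1 : ℤ) n := by
  have hn : (0 : ℤ) < n := by exact_mod_cast Nat.pos_of_ne_zero (NeZero.ne n)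
  have h1 := Int.emod_nonneg (i - 1) hn.ne'
  have h2 := Int.emod_lt_of_pos (i - 1) hn
  simp only [redMod, Finset.mem_Icc]
  omega

theorem redMod_eq (n : ℕ) (i : ℤ) : redMod n i = i + -((i - 1) / n) * n := by
  have := Int.emod_add_mul_ediv (i - 1) n
  simp only [redMod]
  linarith

theorem redMod_add_mul (n : ℕ) (k i : ℤ) : redMod n (i + k * n) = redMod n i := by
  simp only [redMod]
  rw [show i + k * n - 1 = (i - 1) + k * n by ring, Int.add_mul_emod_self_right]

theorem redMod_of_mem {n : ℕ} {i : ℤ} (hi : i ∈ Finset.Icc (1 : ℤ) n) : redMod n i = i := by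
  rw [Finset.mem_Icc] at hi
  rw [redMod, Int.emod_eq_of_lt (by omega) (by omega)]
  ring

theorem forall_of_periodic {n : ℕ} [NeZero n] {P : ℤ → Prop} (hP : ∀ i, P (i + n) = P i)
    (h : ∀ i ∈ Finset.Icc (1 : ℤ) n, P i) (i : ℤ) : P i := by
  have := h _ (redMod_mem n i)
  rwa [redMod_eq, apply_add_mul_of_periodic hP] at this

/-- An affine permutation permutes the residues modulo `n`. This drives the additivity of `k`, the
length estimates and the energy identity. -/
theorem sum_comp_affPerm {n : ℕ} [NeZero n] {M : Type*} [AddCommMonoid M] (u : AffPerm n)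
    {φ : ℤ → M} (hφ : ∀ i, φ (i + n) = φ i) :
    ∑ i ∈ Finset.Icc (1 : ℤ) n, φ (u.1 i) = ∑ i ∈ Finset.Icc (1 : ℤ) n, φ i := by
  refine Finset.sum_nbij' (fun i => redMod n (u.1 i)) (fun i => redMod n ((u⁻¹).1 i))
    (fun _ _ => redMod_mem n _) (fun _ _ => redMod_mem n _) ?_ ?_ ?_
  · intro i hi
    rw [redMod_eq n (u.1 i), affPerm_apply_add_mul, redMod_add_mul]
    simpa using redMod_of_mem hi
  · intro i hi
    rw [redMod_eq n ((u⁻¹).1 i), affPerm_apply_add_mul, redMod_add_mul]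
    simpa using redMod_of_mem hi
  · intro i _
    rw [redMod_eq, apply_add_mul_of_periodic hφ]

theorem kNum_mul {n : ℕ} [NeZero n] (a b : AffPerm n) : kNum (a * b) = kNum a + kNum b := by
  have h := sum_comp_affPerm b (φ := fun i => (a.1 i : ℚ) - i) (by
    intro i
    simp only [a.2 i]
    push_cast
    ring)
  unfold kNum
  rw [← h, ← add_div, ← Finset.sum_add_distrib]
  congr 1
  refine Finset.sum_congr rfl fun i _ => ?_
  simp

theorem kNum_one (n : ℕ) : kNum (1 : AffPerm n) = 0 := by
  simp [kNum]

theorem kNum_inv {n : ℕ} [NeZero n] (a : AffPerm n) : kNum a⁻¹ = -kNum a := by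
  have := kNum_mul a a⁻¹
  rw [mul_inv_cancel, kNum_one] at this
  linarith

theorem kNum_pow {n : ℕ} [NeZero n] (a : AffPerm n) (N : ℕ) : kNum (a ^ N) = N * kNum a := by
  induction N with
  | zero => simp [kNum_one]
  | succ N ih =>
    rw [pow_succ, kNum_mul, ih]
    push_cast
    ring

/-! ### Length and simple reflections -/

theorem simpleRefl_mul_self {n : ℕ} (hn : 2 ≤ n) (a : ℤ) :
    simpleRefl hn a * simpleRefl hn a = 1 :=
  Subtype.ext (Equiv.ext (simpleReflFun_involutive hn a))

theorem simpleRefl_apply_apply {n : ℕ} (hn : 2 ≤ n) (a i : ℤ) :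
    (simpleRefl hn a).1 ((simpleRefl hn a).1 i) = i :=
  simpleReflFun_involutive hn a i

theorem simpleRefl_inv {n : ℕ} (hn : 2 ≤ n) (a : ℤ) :
    (simpleRefl hn a)⁻¹ = simpleRefl hn a :=
  inv_eq_of_mul_eq_one_left (simpleRefl_mul_self hn a)

theorem kNum_simpleRefl {n : ℕ} [NeZero n] (hn : 2 ≤ n) (a : ℤ) : kNum (simpleRefl hn a) = 0 := by
  have := kNum_mul (simpleRefl hn a) (simpleRefl hn a)
  rw [simpleRefl_mul_self, kNum_one] at this
  linarith

theorem simpleRefl_apply_of_dvd {n : ℕ} (hn : 2 ≤ n) {a i : ℤ} (h : (n : ℤ) ∣ i - a) :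
    (simpleRefl hn a).1 i = i + 1 := by
  change simpleReflFun n a i = i + 1
  simp [simpleReflFun, h]

theorem simpleRefl_apply_add_one_of_dvd {n : ℕ} (hn : 2 ≤ n) {a i : ℤ} (h : (n : ℤ) ∣ i - a) :
    (simpleRefl hn a).1 (i + 1) = i := by
  rw [← simpleRefl_apply_of_dvd hn h, simpleRefl_apply_apply]

/-- The only inversions of `s_a` are the pairs `(p, p + 1)` with `p ≡ a`. -/
theorem dvd_of_simpleRefl_lt {n : ℕ} (hn : 2 ≤ n) {a p q : ℤ} (h : p < q)
    (hs : (simpleRefl hn a).1 q < (simpleRefl hn a).1 p) : (n : ℤ) ∣ p - a ∧ q = p + 1 := by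
  change simpleReflFun n a q < simpleReflFun n a p at hs
  by_cases hp : (n : ℤ) ∣ p - a
  · refine ⟨hp, ?_⟩
    unfold simpleReflFun at hs
    rw [if_pos hp] at hs
    split_ifs at hs <;> omega
  · exfalso
    unfold simpleReflFun at hs
    rw [if_neg hp] at hs
    split_ifs at hs with h1 h2 h3 h4 h5
    · omega
    · omega
    · omega
    · have : q = p + 1 := by omega
      subst this
      exact hp (by rwa [show p - a = p + 1 - (a + 1) by ring])
    · omega
    · omega

/-- The second components of the inversions `(p, q)` of `u`. -/
def invAt {n : ℕ} (u : AffPerm n) (p : ℤ) : Set ℤ := {q | p < q ∧ u.1 q < u.1 p}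

theorem invAt_add_mul {n : ℕ} (u : AffPerm n) (k p : ℤ) :
    invAt u (p + k * n) = (fun q : ℤ => q + k * n) '' invAt u p := by
  ext q
  simp only [invAt, Set.mem_ofPred_eq, Set.mem_image]
  constructor
  · rintro ⟨h1, h2⟩
    have e := affPerm_apply_add_mul u k (q - k * n)
    rw [sub_add_cancel] at e
    rw [affPerm_apply_add_mul] at h2
    exact ⟨q - k * n, ⟨by linarith, by linarith⟩, by ring⟩
  · rintro ⟨m, ⟨h1, h2⟩, rfl⟩
    rw [affPerm_apply_add_mul, affPerm_apply_add_mul]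
    exact ⟨by linarith, by linarith⟩

theorem invAt_finite {n : ℕ} [NeZero n] (u : AffPerm n) (p : ℤ) : (invAt u p).Finite := by
  have h := redMod_eq n p
  have h' : (invAt u (redMod n p)).Finite := by
    refine ((inversions_finite u).image Prod.snd).subset fun q hq => ?_
    exact ⟨(redMod n p, q), ⟨hq.1, hq.2, by simpa using redMod_mem n p⟩, rfl⟩
  rw [h, invAt_add_mul] at h'
  exact h'.of_finite_image (add_left_injective _).injOn

theorem ncard_invAt_add {n : ℕ} (u : AffPerm n) (p : ℤ) :
    (invAt u (p + n)).ncard = (invAt u p).ncard := by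
  have := invAt_add_mul u 1 p
  rw [one_mul] at this
  rw [this, Set.ncard_image_of_injective _ (add_left_injective _)]

/-- Grouping inversions by their first entry gives a periodic summand, so `sum_comp_affPerm` can
reindex the length. -/
theorem length_eq_sum {n : ℕ} [NeZero n] (u : AffPerm n) :
    length u = ∑ p ∈ Finset.Icc (1 : ℤ) n, (invAt u p).ncard := by
  classical
  have hfin := inversions_finite u
  rw [length, Set.ncard_eq_toFinset_card _ hfin,
    Finset.card_eq_sum_card_fiberwise (f := Prod.fst) (t := Finset.Icc (1 : ℤ) n)]
  · refine Finset.sum_congr rfl fun p hp => ?_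
    rw [← Set.ncard_image_of_injective (invAt u p) (Prod.mk_right_injective p),
      ← Set.ncard_coe_finset]
    congr 1
    ext ⟨a, b⟩
    simp only [Finset.coe_filter, Set.Finite.mem_toFinset, Set.mem_ofPred_eq, Set.mem_image,
      Prod.mk.injEq, inversions, invAt]
    rw [Finset.mem_Icc] at hp
    constructor
    · rintro ⟨⟨h1, h2, h3⟩, rfl⟩
      exact ⟨b, ⟨h1, h2⟩, rfl, rfl⟩
    · rintro ⟨q, ⟨h1, h2⟩, rfl, rfl⟩
      exact ⟨⟨h1, h2, hp⟩, rfl⟩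
  · intro p hp
    have := (hfin.mem_toFinset.1 hp).2.2
    simpa using this

/-- Applying `s` to both entries embeds the inversions of `u * s` into those of `u`, and the
inversion `(a, a + 1)` is missed. -/
theorem length_mul_simpleRefl_lt {n : ℕ} [NeZero n] (hn : 2 ≤ n) {a : ℤ}
    (ha : a ∈ Finset.Icc (1 : ℤ) n) (u : AffPerm n) (hd : u.1 (a + 1) < u.1 a) :
    length (u * simpleRefl hn a) < length u := by
  set s := simpleRefl hn a with hs
  have hss : ∀ i, s.1 (s.1 i) = i := simpleRefl_apply_apply hn a
  have hmul : ∀ i, (u * s).1 i = u.1 (s.1 i) := fun i => rfl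
  have hsub : ∀ p, s.1 '' invAt (u * s) (s.1 p) ⊆ invAt u p := by
    rintro p _ ⟨q, ⟨h1, h2⟩, rfl⟩
    rw [hmul, hmul, hss] at h2
    refine ⟨?_, h2⟩
    -- If `s` reversed the pair `(s p, q)`, it would be a translate of `(a, a + 1)`, and `u * s` has
    -- no inversion there because `u` descends at `a`.
    by_contra hle
    rcases (not_lt.1 hle).lt_or_eq with h | h
    · rw [← hss p] at h
      obtain ⟨hdv, hq⟩ := dvd_of_simpleRefl_lt hn h1 h
      have e1 : p = s.1 p + 1 := by rw [← simpleRefl_apply_of_dvd hn hdv, ← hs, hss]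
      have e2 : s.1 q = s.1 p := by rw [hq, hs, simpleRefl_apply_add_one_of_dvd hn hdv]
      obtain ⟨k, hk⟩ := hdv
      have e3 : s.1 p = a + k * n := by linarith
      have e4 : p = a + 1 + k * n := by linarith
      rw [e2] at h2
      have e5 := affPerm_apply_add_mul u k a
      have e6 := affPerm_apply_add_mul u k (a + 1)
      rw [← e3] at e5
      rw [← e4] at e6
      omega
    · rw [h] at h2
      exact lt_irrefl _ h2
  rw [length_eq_sum, length_eq_sum, ← sum_comp_affPerm s (ncard_invAt_add _)]
  have hcard : ∀ p, (invAt (u * s) (s.1 p)).ncard = (s.1 '' invAt (u * s) (s.1 p)).ncard :=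
    fun p => (Set.ncard_image_of_injective _ s.1.injective).symm
  refine Finset.sum_lt_sum (fun p _ => ?_) ⟨a, ha, ?_⟩
  · rw [hcard]
    exact Set.ncard_le_ncard (hsub p) (invAt_finite u p)
  · rw [hcard]
    refine Set.ncard_lt_ncard ⟨hsub a, fun h => ?_⟩ (invAt_finite u a)
    obtain ⟨q, ⟨h1, -⟩, hq⟩ := h (show a + 1 ∈ invAt u a from ⟨by omega, hd⟩)
    have e : s.1 a = a + 1 := simpleRefl_apply_of_dvd hn (by simp)
    rw [← e] at hq
    have := s.1.injective hq
    omega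

/-- A new inversion `(p, q)` must have `u p ≡ a` and `u q = u p + 1`. One residue class of `p`
qualifies, and `p` determines `q`; `φ` is the indicator of the class of `a`. -/
theorem length_simpleRefl_mul_le {n : ℕ} [NeZero n] (hn : 2 ≤ n) {a : ℤ}
    (ha : a ∈ Finset.Icc (1 : ℤ) n) (u : AffPerm n) :
    length (simpleRefl hn a * u) ≤ length u + 1 := by
  classical
  let φ : ℤ → ℕ := fun i => if (n : ℤ) ∣ i - a then 1 else 0
  have hφ : ∀ i, φ (i + n) = φ i := fun i => by
    simp only [φ, show i + n - a = (i - a) + n by ring, dvd_add_self_right]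
  have hone : ∑ p ∈ Finset.Icc (1 : ℤ) n, φ (u.1 p) ≤ 1 := by
    rw [sum_comp_affPerm u hφ, Finset.sum_eq_single a]
    · simp only [φ]
      split_ifs <;> simp
    · intro b hb hba
      simp only [φ]
      rw [if_neg]
      rintro ⟨k, hk⟩
      have e : b = a + k * n := by linarith
      have := redMod_add_mul n k a
      rw [← e, redMod_of_mem hb, redMod_of_mem ha] at this
      exact hba this
    · exact fun h => absurd ha h
  rw [length_eq_sum, length_eq_sum]
  refine le_trans ?_ (Nat.add_le_add_left hone _)
  rw [← Finset.sum_add_distrib]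
  refine Finset.sum_le_sum fun p _ => ?_
  have key : ∀ q ∈ invAt (simpleRefl hn a * u) p,
      q ∈ invAt u p ∨ ((n : ℤ) ∣ u.1 p - a ∧ q = u.1.symm (u.1 p + 1)) := by
    rintro q ⟨h1, h2⟩
    rcases lt_trichotomy (u.1 q) (u.1 p) with h | h | h
    · exact Or.inl ⟨h1, h⟩
    · exact absurd (u.1.injective h) h1.ne'
    · obtain ⟨h3, h4⟩ := dvd_of_simpleRefl_lt hn h h2
      exact Or.inr ⟨h3, by rw [← h4]; simp⟩
  by_cases hd : (n : ℤ) ∣ u.1 p - a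
  · simp only [φ, if_pos hd]
    refine le_trans (Set.ncard_le_ncard (t := insert (u.1.symm (u.1 p + 1)) (invAt u p)) ?_
      ((invAt_finite u p).insert _)) (Set.ncard_insert_le _ _)
    intro q hq
    rcases key q hq with h | h
    · exact Or.inr h
    · exact Or.inl h.2
  · simp only [φ, if_neg hd, add_zero]
    refine Set.ncard_le_ncard (fun q hq => ?_) (invAt_finite u p)
    exact (key q hq).resolve_right fun h => hd h.1

/-- Right multiplication lowers the length by at least one, left multiplication raises it by at most
one. -/
theorem conjStep_of_descent {n : ℕ} [NeZero n] (hn : 2 ≤ n) {a : ℤ}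
    (ha : a ∈ Finset.Icc (1 : ℤ) n) (h : AffPerm n) (hd : h.1 (a + 1) < h.1 a) :
    ConjStep h (simpleRefl hn a * h * simpleRefl hn a) := by
  refine ⟨hn, a, by simpa using ha, rfl, ?_⟩
  have h1 := length_mul_simpleRefl_lt hn ha h hd
  have h2 := length_simpleRefl_mul_le hn ha (h * simpleRefl hn a)
  rw [← mul_assoc] at h2
  omega

/-! ### A criterion for `ConjTo` -/

/-- Both `w` and `1` standardize the equally spaced configuration `i ↦ i / n`, and the
standardization is unique. -/
theorem eq_one_of_strictMono {n : ℕ} [NeZero n] (w : AffPerm n) (h0 : kNum w = 0)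
    (hw : StrictMono w.1) : w = 1 := by
  have hn : (0 : ℝ) < n := by exact_mod_cast Nat.pos_of_ne_zero (NeZero.ne n)
  let x : Config n := ⟨fun i => i / n, fun i => by push_cast; field_simp⟩
  have hd : ∀ i j : ℤ, x.toL.diff i j = ((j - i : ℤ) : ℝ) / n := fun i j => by
    change (j : ℝ) / n - i / n = _
    push_cast
    ring
  have hx : x.toL.IsGeneric := fun i j hij => by
    rw [hd]
    exact div_ne_zero (by exact_mod_cast sub_ne_zero.2 hij.symm) hn.ne'
  have hpos : ∀ i j : ℤ, 0 < x.toL.diff i j ↔ i < j := fun i j => by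
    rw [hd, div_pos_iff_of_pos_right hn, Int.cast_pos, sub_pos]
  rw [eq_standardization x.toL hx w h0 fun i j => by rw [hpos, hw.lt_iff_lt],
    eq_standardization x.toL hx 1 (kNum_one n) fun i j => by rw [hpos]; rfl]

/-- Induction on `ℓ(w)`, removing one right descent of `w` at a time. The first half of the
conclusion of `H` makes this a descent of `h`, hence an admissible step; the second half is what
lets `H` pass to `w * s` and `s * h * s`. -/
theorem conjTo_conj {n : ℕ} [NeZero n] (w h : AffPerm n) (h0 : kNum w = 0)
    (H : ∀ a b, a < b → w.1 b < w.1 a → h.1 b < h.1 a ∧ w.1 (h.1 b) < w.1 (h.1 a)) :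
    ConjTo h (w * h * w⁻¹) := by
  induction hN : length w using Nat.strong_induction_on generalizing w h with
  | _ N ih =>
  subst hN
  by_cases hdesc : ∃ a ∈ Finset.Icc (1 : ℤ) n, w.1 (a + 1) < w.1 a
  · obtain ⟨a, ha, hd⟩ := hdesc
    -- For `n = 1` one has `w (a + 1) = w a + 1`, so there is no descent.
    have hn : 2 ≤ n := by
      by_contra hlt
      have h1 : n = 1 := by have := NeZero.ne n; omega
      have := w.2 a
      rw [show a + (n : ℤ) = a + 1 by omega] at this
      omega
    set s := simpleRefl hn a with hs
    have hss : ∀ i, s.1 (s.1 i) = i := simpleRefl_apply_apply hn a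
    have hwd : ∀ i, (n : ℤ) ∣ i - a → w.1 (i + 1) < w.1 i := by
      rintro i ⟨k, hk⟩
      have e1 := affPerm_apply_add_mul w k a
      have e2 := affPerm_apply_add_mul w k (a + 1)
      rw [show a + k * n = i by linarith] at e1
      rw [show a + 1 + k * n = i + 1 by linarith] at e2
      omega
    have step : ConjStep h (s * h * s) :=
      conjStep_of_descent hn ha h (H a (a + 1) (by omega) hd).1
    have e : w * s * (s * h * s) * (w * s)⁻¹ = w * h * w⁻¹ := by
      have h2 : s * s = 1 := simpleRefl_mul_self hn a
      rw [mul_inv_rev, hs, simpleRefl_inv, ← hs]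
      calc w * s * (s * h * s) * (s * w⁻¹) = w * (s * s) * h * (s * s) * w⁻¹ := by group
        _ = w * h * w⁻¹ := by rw [h2, mul_one, mul_one]
    rw [← e]
    refine Relation.ReflTransGen.head step
      (ih _ (length_mul_simpleRefl_lt hn ha w hd) _ _ ?_ ?_ rfl)
    · rw [kNum_mul, h0, kNum_simpleRefl, add_zero]
    · intro p q hpq hw
      change w.1 (s.1 q) < w.1 (s.1 p) at hw
      change s.1 (h.1 (s.1 q)) < s.1 (h.1 (s.1 p)) ∧
        w.1 (s.1 (s.1 (h.1 (s.1 q)))) < w.1 (s.1 (s.1 (h.1 (s.1 p))))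
      rw [hss, hss]
      -- The only pairs reversed by `s` are translates of `(a, a + 1)`. These are inversions of `w`,
      -- hence not of `w * s`.
      have hlt : s.1 p < s.1 q := by
        by_contra hle
        rcases (not_lt.1 hle).lt_or_eq with h' | h'
        · obtain ⟨h1, rfl⟩ := dvd_of_simpleRefl_lt hn hpq h'
          rw [hs, simpleRefl_apply_of_dvd hn h1, simpleRefl_apply_add_one_of_dvd hn h1] at hw
          exact absurd (hwd p h1) hw.not_gt
        · exact absurd (s.1.injective h') hpq.ne'
      obtain ⟨h1, h2⟩ := H _ _ hlt hw
      refine ⟨?_, h2⟩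
      -- A reversal here would make `(h (s q), h (s p))` a translate of `(a, a + 1)`, which `w`
      -- inverts, contrary to `h2`.
      by_contra hle
      rcases (not_lt.1 hle).lt_or_eq with h' | h'
      · obtain ⟨h3, h4⟩ := dvd_of_simpleRefl_lt hn h1 h'
        rw [h4] at h2
        exact absurd (hwd _ h3) h2.not_gt
      · exact absurd (s.1.injective h') h1.ne'
  · have hmono : StrictMono w.1 := by
      refine strictMono_int_of_lt_succ fun i => ?_
      refine forall_of_periodic (n := n) (P := fun i => w.1 i < w.1 (i + 1)) (fun i => ?_)
        (fun i hi => ?_) i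
      · simp only [show i + n + 1 = i + 1 + n by ring, w.2 i, w.2 (i + 1), add_lt_add_iff_right]
      · by_contra hle
        rcases (not_lt.1 hle).lt_or_eq with h' | h'
        · exact hdesc ⟨i, hi, h'⟩
        · have := w.1.injective h'
          omega
    rw [eq_one_of_strictMono w h0 hmono, one_mul, inv_one, mul_one]
    exact Relation.ReflTransGen.refl

/-- `Diag_f(x) → Diag_f(y)` if every pair of points that changes its order from `x` to `y` is mapped
by `f` to a pair that has the new order both in `x` and in `y`. -/
theorem diagTo_of_crossings {n : ℕ} [NeZero n] (f : AffPerm n) (x y : LSpace n)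
    (hx : x.IsGeneric) (hy : y.IsGeneric)
    (H : ∀ i j, 0 < x.diff i j → 0 < y.diff j i →
      0 < x.diff (f.1 j) (f.1 i) ∧ 0 < y.diff (f.1 j) (f.1 i)) : DiagTo f x hx y hy := by
  obtain ⟨kx, gx⟩ := standardization_spec x hx
  obtain ⟨ky, gy⟩ := standardization_spec y hy
  unfold DiagTo diagPerm
  set g := standardization x hx
  set g' := standardization y hy
  -- The inversions of `g' * g⁻¹` are the `g`-images of the pairs that change their order.
  have e : g' * f * g'⁻¹ = (g' * g⁻¹) * (g * f * g⁻¹) * (g' * g⁻¹)⁻¹ := by group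
  rw [e]
  refine conjTo_conj _ _ ?_ ?_
  · rw [kNum_mul, kNum_inv, kx, ky, neg_zero, add_zero]
  · intro a b hab hw
    obtain ⟨i, rfl⟩ := g.1.surjective a
    obtain ⟨j, rfl⟩ := g.1.surjective b
    have e1 : ∀ i, (g' * g⁻¹).1 (g.1 i) = g'.1 i := fun i => by simp
    have e2 : ∀ i, (g * f * g⁻¹).1 (g.1 i) = g.1 (f.1 i) := fun i => by simp
    rw [e1, e1] at hw
    rw [e2, e2, e1, e1, gx, gy]
    exact H i j ((gx i j).1 hab) ((gy j i).1 hw)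

/-! ### The flow -/

/-- The coordinate `x(i)` of the map `x` given by `x(i) - c i / n = p(i)` with `p` periodic. -/
noncomputable def coordMap (n : ℕ) [NeZero n] (i : ℤ) : (ZMod n → ℝ) × ℝ →L[ℝ] ℝ :=
  (ContinuousLinearMap.proj (i : ZMod n)).comp (ContinuousLinearMap.fst ℝ _ _) +
    ((i : ℝ) / n) • ContinuousLinearMap.snd ℝ _ _

theorem coordMap_apply {n : ℕ} [NeZero n] (i : ℤ) (v : (ZMod n → ℝ) × ℝ) :
    coordMap n i v = v.1 (i : ZMod n) + (i : ℝ) / n * v.2 := rfl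

/-- The generator of the flow `ẋ(i) = x(f(i)) - x(i)`. -/
noncomputable def flowGen {n : ℕ} [NeZero n] (f : AffPerm n) :
    (ZMod n → ℝ) × ℝ →L[ℝ] (ZMod n → ℝ) × ℝ :=
  (ContinuousLinearMap.pi fun a : ZMod n =>
    coordMap n (f.1 a.val) - coordMap n (a.val : ℤ)).prod 0

/-- `flowGen` prescribes the velocity only at representatives of the residues. Periodicity of `f`
extends the formula to every `i`, since shifting `i` by `n` adds the same amount to both
coordinates. -/
theorem coordMap_flowGen {n : ℕ} [NeZero n] (f : AffPerm n) (i : ℤ) (v : (ZMod n → ℝ) × ℝ) :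
    coordMap n i (flowGen f v) = coordMap n (f.1 i) v - coordMap n i v := by
  have hn : (n : ℝ) ≠ 0 := by exact_mod_cast NeZero.ne n
  have e : coordMap n i (flowGen f v) = coordMap n (f.1 ((i : ZMod n).val : ℤ)) v -
      coordMap n ((i : ZMod n).val : ℤ) v := by
    rw [coordMap_apply]
    simp [flowGen]
  have hi : ((i : ZMod n).val : ℤ) = i + -(i / n) * n := by
    rw [ZMod.val_intCast]
    have := Int.emod_add_mul_ediv i n
    linarith
  rw [e, hi, affPerm_apply_add_mul]
  simp only [coordMap_apply]
  push_cast
  simp only [ZMod.natCast_self, mul_zero, add_zero]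
  ring

/-- Quasi-periodicity reduces the infinite system to a linear one in finite dimension, solved by the
operator exponential; this also gives analyticity in time. -/
theorem exists_flow {n : ℕ} [NeZero n] (f : AffPerm n) (x : Config n) :
    ∃ X : ℝ → Config n, X 0 = x ∧
      (∀ i t, HasDerivAt (fun s => (X s).pos i) ((X t).pos (f.1 i) - (X t).pos i) t) ∧
      ∀ i, AnalyticOnNhd ℝ (fun s => (X s).pos i) Set.univ := by
  have hn : (n : ℝ) ≠ 0 := by exact_mod_cast NeZero.ne n
  let v : (ZMod n → ℝ) × ℝ := (fun a => x.pos a.val - (a.val : ℝ) / n, 1)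
  let ev : ((ZMod n → ℝ) × ℝ →L[ℝ] (ZMod n → ℝ) × ℝ) →L[ℝ] (ZMod n → ℝ) × ℝ :=
    ContinuousLinearMap.apply ℝ _ v
  let u : ℝ → (ZMod n → ℝ) × ℝ := fun t => NormedSpace.exp (t • flowGen f) v
  have hu : ∀ t, HasDerivAt u (flowGen f (u t)) t := fun t =>
    ev.hasFDerivAt.comp_hasDerivAt t (hasDerivAt_exp_smul_const' (𝕂 := ℝ) (flowGen f) t)
  -- The last component of `flowGen` is zero, so `c = 1` is conserved, and with it `x (i + n) = x i
  -- + 1`.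
  have hsnd : ∀ t, (u t).2 = 1 := by
    have hd : ∀ t, HasDerivAt (fun t => (u t).2) 0 t := fun t =>
      (ContinuousLinearMap.snd ℝ (ZMod n → ℝ) ℝ).hasFDerivAt.comp_hasDerivAt t (hu t)
    intro t
    rw [is_const_of_deriv_eq_zero (fun t => (hd t).differentiableAt) (fun t => (hd t).deriv) t 0]
    simp [u, v]
  let X : ℝ → Config n := fun t => ⟨fun i => coordMap n i (u t), fun i => by
    simp only [coordMap_apply, hsnd]
    push_cast
    rw [ZMod.natCast_self]
    rw [add_div, div_self hn]
    ring_nf⟩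
  refine ⟨X, ?_, fun i t => ?_, fun i => ?_⟩
  · have hpos : (X 0).pos = x.pos := by
      funext i
      have e : (X 0).pos i = x.pos (i : ZMod n).val - ((i : ZMod n).val : ℝ) / n + i / n := by
        simp [X, u, v, coordMap_apply]
      have hp : (fun i : ℤ => x.pos i - (i : ℝ) / n) (i + -(i / n) * n) = x.pos i - i / n :=
        apply_add_mul_of_periodic (φ := fun i : ℤ => x.pos i - (i : ℝ) / n) (fun i => by
          simp only [x.add_period]
          push_cast
          field_simp
          ring) _ _
      have hi : ((i : ZMod n).val : ℤ) = i + -(i / n) * n := by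
        rw [ZMod.val_intCast]
        have := Int.emod_add_mul_ediv i n
        linarith
      rw [← hi] at hp
      rw [e]
      push_cast at hp
      linarith
    cases x
    simp only [X] at hpos ⊢
    congr
  · have := (coordMap n i).hasFDerivAt.comp_hasDerivAt t (hu t)
    rw [coordMap_flowGen] at this
    exact this
  · have h1 : AnalyticOnNhd ℝ (fun t : ℝ => NormedSpace.exp (t • flowGen f)) Set.univ := by
      intro t _
      exact (NormedSpace.exp_analytic (𝕂 := ℝ) (t • flowGen f)).fun_comp
        (f := fun t : ℝ => t • flowGen f)
        (analyticAt_id.smul analyticAt_const)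
    exact fun t ht => ((coordMap n i).comp ev).comp_analyticOnNhd h1 t ht

/-! ### Collisions -/

theorem isGeneric_toL_iff {n : ℕ} (x : Config n) :
    x.toL.IsGeneric ↔ Function.Injective x.pos := by
  have h : ∀ i j, x.toL.diff i j = x.pos j - x.pos i := fun _ _ => rfl
  simp only [LSpace.IsGeneric, h, sub_ne_zero]
  exact ⟨fun H i j hij => by_contra fun hne => H i j hne hij.symm,
    fun H i j hne hij => hne (H hij.symm)⟩

/-- Infinitely many zeros in a compact interval accumulate, and the identity theorem would make `g`
vanish everywhere. -/
theorem finite_zeros_of_analytic {g : ℝ → ℝ} (hg : AnalyticOnNhd ℝ g Set.univ) {a : ℝ}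
    (ha : g a ≠ 0) (b c : ℝ) : {t | t ∈ Set.Icc b c ∧ g t = 0}.Finite := by
  by_contra hinf
  obtain ⟨z, -, hz⟩ := Set.Infinite.exists_accPt_of_subset_isCompact (K := Set.Icc b c) hinf
    isCompact_Icc fun t ht => ht.1
  have hfr : ∃ᶠ t in nhdsWithin z {z}ᶜ, g t = (fun _ => (0 : ℝ)) t :=
    (accPt_iff_frequently_nhdsNE.1 hz).mono fun t ht => ht.2
  exact ha (congrFun (hg.eq_of_frequently_eq analyticOnNhd_const hfr) a)

theorem exists_bound_pos {n : ℕ} [NeZero n] {X : ℝ → Config n}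
    (hX : ∀ i, Continuous fun t => (X t).pos i) (B : ℝ) :
    ∃ M : ℝ, ∀ t ∈ Set.Icc 0 B, ∀ j : ℤ, |(X t).pos j - (j : ℝ) / n| ≤ M := by
  have hn : (n : ℝ) ≠ 0 := by exact_mod_cast NeZero.ne n
  obtain ⟨M, hM⟩ := (isCompact_Icc (a := (0 : ℝ)) (b := B)).exists_bound_of_continuousOn
    (f := fun t => ∑ j ∈ Finset.Icc (1 : ℤ) n, |(X t).pos j - (j : ℝ) / n|)
    (continuous_finsetSum _ fun j _ => ((hX j).sub continuous_const).abs).continuousOn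
  refine ⟨M, fun t ht => forall_of_periodic (n := n) (fun i => ?_) fun i hi => ?_⟩
  · have : (X t).pos (i + n) - ((i + n : ℤ) : ℝ) / n = (X t).pos i - (i : ℝ) / n := by
      rw [(X t).add_period]
      push_cast
      rw [add_div, div_self hn]
      ring
    rw [this]
  · exact (Finset.single_le_sum (f := fun j : ℤ => |(X t).pos j - (j : ℝ) / n|)
      (fun j _ => abs_nonneg _) hi).trans ((le_abs_self _).trans (hM t ht))

/-- After a shift, one of two colliding points has its index in `[n]`. Since positions stay within
`M` of `j / n`, the indices differ by at most `2 M n`. Finitely many pairs remain, each with an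
analytic difference that is nonzero at time `0`. -/
theorem collisions_finite {n : ℕ} [NeZero n] {X : ℝ → Config n}
    (hX : ∀ i, AnalyticOnNhd ℝ (fun t => (X t).pos i) Set.univ)
    (h0 : (X 0).toL.IsGeneric) (B : ℝ) :
    {t | t ∈ Set.Icc 0 B ∧ ¬ (X t).toL.IsGeneric}.Finite := by
  have hn : (0 : ℝ) < n := by exact_mod_cast Nat.pos_of_ne_zero (NeZero.ne n)
  have hc : ∀ i, Continuous fun t => (X t).pos i := fun i =>
    continuousOn_univ.1 (hX i).continuousOn
  obtain ⟨M, hM⟩ := exists_bound_pos hc B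
  rw [isGeneric_toL_iff] at h0
  have hpair : ∀ i j : ℤ, i ≠ j → {t | t ∈ Set.Icc 0 B ∧ (X t).pos i - (X t).pos j = 0}.Finite :=
    fun i j hij => finite_zeros_of_analytic ((hX i).sub (hX j)) (a := 0)
      (sub_ne_zero.2 (h0.ne hij)) 0 B
  have hfin : (⋃ i ∈ Finset.Icc (1 : ℤ) n, ⋃ j ∈ Finset.Icc (-⌈n * (2 * M)⌉) (n + ⌈n * (2 * M)⌉),
      {t | i ≠ j ∧ t ∈ Set.Icc 0 B ∧ (X t).pos i - (X t).pos j = 0}).Finite := by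
    refine Set.Finite.biUnion (Finset.finite_toSet _) fun i _ =>
      Set.Finite.biUnion (Finset.finite_toSet _) fun j _ => ?_
    by_cases hij : i = j
    · simp [hij]
    · simpa [hij] using hpair i j hij
  refine hfin.subset ?_
  rintro t ⟨ht, hg⟩
  rw [isGeneric_toL_iff, Function.Injective] at hg
  push Not at hg
  obtain ⟨i, j, hij, hne⟩ := hg
  have hsh : ∀ k i : ℤ, (X t).pos (i + k * n) = (X t).pos i + k := by
    intro k i
    have := apply_add_mul_of_periodic (n := n) (φ := fun i : ℤ => (X t).pos i - (i : ℝ) / n)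
      (fun i => by
        simp only [(X t).add_period]
        push_cast
        rw [add_div, div_self hn.ne']
        ring) k i
    push_cast at this
    rw [add_div, mul_div_assoc, div_self hn.ne'] at this
    linarith
  set k := -((i - 1) / n) with hk
  have hmem : i + k * n ∈ Finset.Icc (1 : ℤ) n := by
    rw [hk, ← redMod_eq]
    exact redMod_mem n i
  have heq : (X t).pos (i + k * n) = (X t).pos (j + k * n) := by rw [hsh, hsh, hij]
  have hne' : i + k * n ≠ j + k * n := by simpa using hne
  generalize i + k * n = p at hmem heq hne'
  generalize j + k * n = q at heq hne'
  simp only [Set.mem_iUnion]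
  refine ⟨p, hmem, q, ?_, hne', ht, by rw [heq, sub_self]⟩
  have h1 := abs_le.1 (hM t ht p)
  have h2 := abs_le.1 (hM t ht q)
  rw [heq] at h1
  have h3 : |((q - p : ℤ) : ℝ) / n| ≤ 2 * M := by
    push_cast
    rw [sub_div, abs_le]
    constructor <;> linarith [h1.1, h1.2, h2.1, h2.2]
  rw [abs_div, abs_of_pos hn, div_le_iff₀ hn, mul_comm] at h3
  have h4 : |q - p| ≤ ⌈n * (2 * M)⌉ := by
    have := h3.trans (Int.le_ceil _)
    exact_mod_cast this
  rw [abs_le] at h4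
  rw [Finset.mem_Icc] at hmem ⊢
  omega

theorem hasDerivAt_exp_mul {d df : ℝ → ℝ} {t : ℝ} (hd : HasDerivAt d (df t - d t) t) :
    HasDerivAt (fun t => Real.exp t * d t) (Real.exp t * df t) t := by
  exact ((Real.hasDerivAt_exp t).fun_mul hd).congr_deriv (by ring)

/-- `e^τ d` increases from a negative value to `0` on `[s, z]` and from `0` to a positive value on
`[z, t]`. The mean value theorem makes `df` positive somewhere inside each interval, and `df` cannot
change sign away from `z`. The case `df z = 0` is allowed. -/
theorem pos_of_crossing {d df : ℝ → ℝ} {s t z : ℝ} (hst : s ≤ t)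
    (hd : ∀ τ, HasDerivAt d (df τ - d τ) τ) (hdf : Continuous df)
    (hs : d s < 0) (ht : 0 < d t)
    (hz : ∀ τ ∈ Set.Icc s t, d τ = 0 → τ = z) (hzf : ∀ τ ∈ Set.Icc s t, df τ = 0 → τ = z) :
    0 < df s ∧ 0 < df t := by
  have hdc : Continuous d := continuous_iff_continuousAt.2 fun τ => (hd τ).continuousAt
  obtain ⟨z', hz', hdz⟩ := intermediate_value_Icc hst hdc.continuousOn ⟨hs.le, ht.le⟩
  obtain rfl := hz z' hz' hdz
  have hsz : s < z' := lt_of_le_of_ne hz'.1 fun h => by rw [h, hdz] at hs; exact lt_irrefl _ hs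
  have hzt : z' < t := lt_of_le_of_ne hz'.2 fun h => by rw [← h, hdz] at ht; exact lt_irrefl _ ht
  have hE := fun τ => hasDerivAt_exp_mul (hd τ)
  have hEc : Continuous fun τ => Real.exp τ * d τ := Real.continuous_exp.mul hdc
  constructor
  · obtain ⟨τ, hτ, he⟩ := exists_hasDerivAt_eq_slope _ _ hsz hEc.continuousOn fun τ _ => hE τ
    have h1 : 0 < df τ := by
      refine pos_of_mul_pos_right (a := Real.exp τ) ?_ (Real.exp_pos _).le
      rw [he, hdz, mul_zero]
      exact div_pos (by linarith [mul_neg_of_pos_of_neg (Real.exp_pos s) hs]) (sub_pos.2 hsz)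
    by_contra hle
    obtain ⟨ρ, hρ, h0⟩ := intermediate_value_Icc hτ.1.le hdf.continuousOn ⟨not_lt.1 hle, h1.le⟩
    have := hzf ρ ⟨hρ.1, by linarith [hρ.2, hτ.2]⟩ h0
    linarith [hρ.2, hτ.2]
  · obtain ⟨τ, hτ, he⟩ := exists_hasDerivAt_eq_slope _ _ hzt hEc.continuousOn fun τ _ => hE τ
    have h1 : 0 < df τ := by
      refine pos_of_mul_pos_right (a := Real.exp τ) ?_ (Real.exp_pos _).le
      rw [he, hdz, mul_zero, sub_zero]
      exact div_pos (mul_pos (Real.exp_pos _) ht) (sub_pos.2 hzt)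
    by_contra hle
    obtain ⟨ρ, hρ, h0⟩ := intermediate_value_Icc' hτ.2.le hdf.continuousOn ⟨not_lt.1 hle, h1.le⟩
    have := hzf ρ ⟨by linarith [hρ.1, hτ.1], hρ.2⟩ h0
    linarith [hρ.1, hτ.1]

theorem diagTo_of_flow_of_collision {n : ℕ} [NeZero n] (f : AffPerm n) {X : ℝ → Config n}
    (hX : ∀ i t, HasDerivAt (fun s => (X s).pos i) ((X t).pos (f.1 i) - (X t).pos i) t)
    {s t z : ℝ} (hst : s ≤ t) (hs : (X s).toL.IsGeneric) (ht : (X t).toL.IsGeneric)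
    (hz : ∀ τ ∈ Set.Icc s t, ¬ (X τ).toL.IsGeneric → τ = z) :
    DiagTo f (X s).toL hs (X t).toL ht := by
  have hc : ∀ i, Continuous fun t => (X t).pos i := fun i =>
    continuous_iff_continuousAt.2 fun τ => (hX i τ).continuousAt
  have hne : ∀ i j, i ≠ j → ∀ τ ∈ Set.Icc s t, (X τ).pos i - (X τ).pos j = 0 → τ = z := by
    intro i j hij τ hτ h
    refine hz τ hτ fun hg => hij ?_
    exact (isGeneric_toL_iff _).1 hg (sub_eq_zero.1 h)
  refine diagTo_of_crossings f _ _ hs ht fun i j h1 h2 => ?_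
  change 0 < (X s).pos j - (X s).pos i at h1
  change 0 < (X t).pos i - (X t).pos j at h2
  have hij : i ≠ j := fun h => by rw [h, sub_self] at h1; exact lt_irrefl _ h1
  refine pos_of_crossing (d := fun τ => (X τ).pos i - (X τ).pos j)
    (df := fun τ => (X τ).pos (f.1 i) - (X τ).pos (f.1 j)) hst (fun τ =>
      ((hX i τ).fun_sub (hX j τ)).congr_deriv (by ring)) ((hc _).sub (hc _))
    (by linarith) h2 (hne i j hij) (hne _ _ (f.1.injective.ne hij))

/-- Induction on the number of points of `Z` in `[s, t]`: as long as there are two, cut at a generic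
time between them. -/
theorem diagTo_of_flow {n : ℕ} [NeZero n] (f : AffPerm n) {X : ℝ → Config n}
    (hX : ∀ i t, HasDerivAt (fun s => (X s).pos i) ((X t).pos (f.1 i) - (X t).pos i) t)
    (Z : Finset ℝ) {s t : ℝ} (hst : s ≤ t) (hs : (X s).toL.IsGeneric) (ht : (X t).toL.IsGeneric)
    (hZ : ∀ τ ∈ Set.Icc s t, ¬ (X τ).toL.IsGeneric → τ ∈ Z) :
    DiagTo f (X s).toL hs (X t).toL ht := by
  induction hN : (Z.filter (· ∈ Set.Icc s t)).card using Nat.strong_induction_on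
    generalizing s t with
  | _ N ih =>
  subst hN
  by_cases h : ∃ a ∈ Z.filter (· ∈ Set.Icc s t), ∃ b ∈ Z.filter (· ∈ Set.Icc s t), a < b
  · obtain ⟨a, ha, b, hb, hab⟩ := h
    obtain ⟨m, hm, hmZ⟩ := ((Set.Ioo_infinite hab).sdiff Z.finite_toSet).nonempty
    have ha' := (Finset.mem_filter.1 ha).2
    have hb' := (Finset.mem_filter.1 hb).2
    have hsm : s ≤ m := ha'.1.trans hm.1.le
    have hmt : m ≤ t := hm.2.le.trans hb'.2
    have hg : (X m).toL.IsGeneric := by_contra fun hg => hmZ (hZ m ⟨hsm, hmt⟩ hg)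
    have sub1 : Z.filter (· ∈ Set.Icc s m) ⊂ Z.filter (· ∈ Set.Icc s t) := by
      refine Finset.ssubset_iff_subset_ne.2 ⟨Finset.monotone_filter_right _
        fun τ _ hτ => ⟨hτ.1, hτ.2.trans hmt⟩, fun h => ?_⟩
      rw [← h] at hb
      exact absurd (Finset.mem_filter.1 hb).2.2 (not_le.2 hm.2)
    have sub2 : Z.filter (· ∈ Set.Icc m t) ⊂ Z.filter (· ∈ Set.Icc s t) := by
      refine Finset.ssubset_iff_subset_ne.2 ⟨Finset.monotone_filter_right _
        fun τ _ hτ => ⟨hsm.trans hτ.1, hτ.2⟩, fun h => ?_⟩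
      rw [← h] at ha
      exact absurd (Finset.mem_filter.1 ha).2.1 (not_le.2 hm.1)
    have r1 := ih _ (Finset.card_lt_card sub1) hsm hs hg
      (fun τ hτ => hZ τ ⟨hτ.1, hτ.2.trans hmt⟩) rfl
    have r2 := ih _ (Finset.card_lt_card sub2) hmt hg ht
      (fun τ hτ => hZ τ ⟨hsm.trans hτ.1, hτ.2⟩) rfl
    exact Relation.ReflTransGen.trans r1 r2
  · push Not at h
    have hmem : ∀ τ ∈ Set.Icc s t, ¬ (X τ).toL.IsGeneric → τ ∈ Z.filter (· ∈ Set.Icc s t) :=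
      fun τ hτ hg => Finset.mem_filter.2 ⟨hZ τ hτ hg, hτ⟩
    rcases (Z.filter (· ∈ Set.Icc s t)).eq_empty_or_nonempty with he | ⟨z, hz⟩
    -- Without collisions the value of `z` is immaterial.
    · refine diagTo_of_flow_of_collision f hX (z := 0) hst hs ht fun τ hτ hg => ?_
      have := hmem τ hτ hg
      rw [he] at this
      simp at this
    · exact diagTo_of_flow_of_collision f hX (z := z) hst hs ht fun τ hτ hg =>
        le_antisymm (h z hz τ (hmem τ hτ hg)) (h τ (hmem τ hτ hg) z hz)

/-! ### Slopes and straightness -/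

/-- Pigeonhole on the residues of the forward orbit of `i`. -/
theorem exists_pow_apply_eq {n : ℕ} [NeZero n] (f : AffPerm n) (i : ℤ) :
    ∃ N : ℕ, 0 < N ∧ ∃ c : ℤ, (f ^ N).1 i = i + c * n := by
  have key : ∀ a b : ℕ, a < b → (((f ^ a).1 i : ℤ) : ZMod n) = (((f ^ b).1 i : ℤ) : ZMod n) →
      ∃ N : ℕ, 0 < N ∧ ∃ c : ℤ, (f ^ N).1 i = i + c * n := by
    intro a b hab h
    obtain ⟨c, hc⟩ := (ZMod.intCast_eq_intCast_iff_dvd_sub _ _ n).1 h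
    refine ⟨b - a, by omega, c, (f ^ a).1.injective ?_⟩
    rw [affPerm_apply_add_mul]
    have e : (f ^ a).1 ((f ^ (b - a)).1 i) = (f ^ b).1 i := by
      change (f ^ a * f ^ (b - a)).1 i = _
      rw [← pow_add, Nat.add_sub_cancel' hab.le]
    rw [e]
    linarith
  obtain ⟨a, b, hne, h⟩ := Finite.exists_ne_map_eq_of_infinite
    fun k : ℕ => (((f ^ k).1 i : ℤ) : ZMod n)
  rcases lt_or_gt_of_ne hne with hlt | hlt
  · exact key a b hlt h
  · exact key b a hlt h.symm

/-- On the whole cycle `f ^ N` is the shift by `c * n`, so the restriction `u` satisfies: `u ^ N` is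
the shift by `c * nNum n C`. Additivity of `k` gives `N * kNum u = c * nNum n C`. -/
theorem slope_eq_of_pow_apply_eq {n : ℕ} [NeZero n] (f : AffPerm n) {i : ℤ} {N : ℕ} (hN : 0 < N)
    {c : ℤ} (h : (f ^ N).1 i = i + c * n) : slope f i = c / N := by
  have hn : (n : ℤ) ≠ 0 := by exact_mod_cast NeZero.ne n
  have hC := isFClosed_cycleOf f i
  unfold slope slopeOfSet
  set C := cycleOf f i
  set u := restrict f hC
  have hm := nNum_pos C hC.nonempty hC.periodic
  have : NeZero (nNum n C) := ⟨hm.ne'⟩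
  -- The set of `j` with this property is `f`-closed and contains `i`, hence contains the cycle.
  have hall : ∀ j ∈ C, (f ^ N).1 j = j + c * n := by
    refine fun j hj => hj {j | (f ^ N).1 j = j + c * n} ⟨⟨⟨i, h⟩, fun j => ?_, fun j => ?_⟩, h⟩
    · simp only [Set.mem_ofPred_eq, (f ^ N).2 j]
      constructor <;> intro h <;> linarith
    · simp only [Set.mem_ofPred_eq]
      have e : (f ^ N).1 (f.1 j) = f.1 ((f ^ N).1 j) := by
        change (f ^ N * f).1 j = (f * f ^ N).1 j
        rw [pow_mul_comm']
      rw [e, ← affPerm_apply_add_mul, f.1.injective.eq_iff]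
  have hrank : ∀ j, rank C (j + c * n) = rank C j + c * nNum n C := by
    intro j
    have := apply_add_mul_of_periodic (n := n) (φ := fun j => rank C j * n - j * nNum n C)
      (fun j => by simp only [rank_add_period C hC.periodic]; ring) c j
    refine mul_right_cancel₀ hn ?_
    linarith
  have hu : ∀ (k : ℕ), ∀ j ∈ C, (f ^ k).1 j ∈ C ∧ (u ^ k).1 (rank C j) = rank C ((f ^ k).1 j) := by
    intro k
    induction k with
    | zero => exact fun j hj => ⟨hj, rfl⟩
    | succ k ih =>
      intro j hj
      obtain ⟨h1, h2⟩ := ih j hj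
      have e1 : (f ^ (k + 1)).1 j = f.1 ((f ^ k).1 j) := by rw [pow_succ']; rfl
      have e2 : (u ^ (k + 1)).1 (rank C j) = u.1 ((u ^ k).1 (rank C j)) := by rw [pow_succ']; rfl
      rw [e1, e2, h2]
      refine ⟨(hC.closed _).1 h1, ?_⟩
      change (rankEquiv hC).permCongr (Equiv.Perm.subtypePerm f.1 fun i => (hC.closed i).symm)
        (rankEquiv hC ⟨_, h1⟩) = _
      rw [Equiv.permCongr_apply, Equiv.symm_apply_apply]
      rfl
  have hpow : ∀ r, (u ^ N).1 r = r + c * nNum n C := by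
    intro r
    obtain ⟨⟨j, hj⟩, rfl⟩ := (rankEquiv hC).surjective r
    change (u ^ N).1 (rank C j) = rank C j + _
    rw [(hu N j hj).2, hall j hj, hrank]
  have hm' : (nNum n C : ℚ) ≠ 0 := by exact_mod_cast hm.ne'
  have hN' : (N : ℚ) ≠ 0 := by exact_mod_cast hN.ne'
  have hk : kNum (u ^ N) = c * nNum n C := by
    unfold kNum
    have e : ∀ r : ℤ, (((u ^ N).1 r : ℤ) : ℚ) - r = c * nNum n C := fun r => by
      rw [hpow]
      push_cast
      ring
    rw [div_eq_iff hm', Finset.sum_congr rfl fun r _ => e r]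
    simp
    ring
  rw [kNum_pow] at hk
  rw [div_eq_div_iff hm' hN', ← hk]
  ring

/-- The `N` velocities along the orbit telescope to `c`, so their mean is the slope `c / N`.
Consecutive ones differ by at most `δ`, so each lies within `N * δ` of the first. -/
theorem abs_sub_slope_le {n : ℕ} [NeZero n] (f : AffPerm n) (x : Config n) {δ : ℝ}
    (hδ : ∀ i, |(x.pos (f.1 (f.1 i)) - x.pos (f.1 i)) - (x.pos (f.1 i) - x.pos i)| ≤ δ)
    {i : ℤ} {N : ℕ} (hN : 0 < N) {c : ℤ} (h : (f ^ N).1 i = i + c * n) :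
    |x.pos (f.1 i) - x.pos i - (slope f i : ℝ)| ≤ N * δ := by
  have hn : (n : ℝ) ≠ 0 := by exact_mod_cast NeZero.ne n
  have hδ0 : 0 ≤ δ := (abs_nonneg _).trans (hδ 0)
  have hN' : (0 : ℝ) < N := by exact_mod_cast hN
  have hsucc : ∀ k : ℕ, (f ^ (k + 1)).1 i = f.1 ((f ^ k).1 i) := fun k => by rw [pow_succ']; rfl
  set v : ℤ → ℝ := fun j => x.pos (f.1 j) - x.pos j with hv
  have hsum : ∑ k ∈ Finset.range N, v ((f ^ k).1 i) = c := by
    have e : ∀ k, v ((f ^ k).1 i) = x.pos ((f ^ (k + 1)).1 i) - x.pos ((f ^ k).1 i) :=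
      fun k => by rw [hsucc]
    rw [Finset.sum_congr rfl fun k _ => e k, Finset.sum_range_sub fun k => x.pos ((f ^ k).1 i), h]
    have := apply_add_mul_of_periodic (n := n) (φ := fun j : ℤ => x.pos j - (j : ℝ) / n)
      (fun j => by
        simp only [x.add_period]
        push_cast
        rw [add_div, div_self hn]
        ring) c i
    push_cast at this
    rw [add_div, mul_div_assoc, div_self hn] at this
    simp only [pow_zero, OneMemClass.coe_one, Equiv.Perm.coe_one, id_eq]
    linarith
  have hstep : ∀ k : ℕ, |v i - v ((f ^ k).1 i)| ≤ k * δ := by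
    intro k
    induction k with
    | zero => simp
    | succ k ih =>
      have h1 := hδ ((f ^ k).1 i)
      rw [← hsucc] at h1
      calc |v i - v ((f ^ (k + 1)).1 i)|
          ≤ |v i - v ((f ^ k).1 i)| + |v ((f ^ k).1 i) - v ((f ^ (k + 1)).1 i)| :=
            abs_sub_le _ _ _
        _ ≤ k * δ + δ := by
            refine add_le_add ih ?_
            rw [abs_sub_comm]
            simp only [hv, hsucc] at h1 ⊢
            exact h1
        _ = ((k + 1 : ℕ) : ℝ) * δ := by push_cast; ring
  have hdiff : N * (v i - c / N) = ∑ k ∈ Finset.range N, (v i - v ((f ^ k).1 i)) := by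
    rw [Finset.sum_sub_distrib, hsum]
    simp
    field_simp
  have habs : |N * (v i - c / N)| ≤ N * (N * δ) := by
    rw [hdiff]
    refine (Finset.abs_sum_le_sum_abs _ _).trans ?_
    refine (Finset.sum_le_card_nsmul _ _ (N * δ) fun k hk => ?_).trans (by simp)
    refine (hstep k).trans ?_
    have : (k : ℝ) ≤ N := by exact_mod_cast (Finset.mem_range.1 hk).le
    exact mul_le_mul_of_nonneg_right this hδ0
  rw [abs_mul, abs_of_pos hN'] at habs
  rw [slope_eq_of_pow_apply_eq f hN h]
  push_cast
  exact le_of_mul_le_mul_left habs hN'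

theorem exists_pos_isStraight {n : ℕ} [NeZero n] (f : AffPerm n) {ε : ℝ} (hε : 0 < ε) :
    ∃ δ > 0, ∀ x : Config n,
      (∀ i, |(x.pos (f.1 (f.1 i)) - x.pos (f.1 i)) - (x.pos (f.1 i) - x.pos i)| ≤ δ) →
      x.toL.IsStraight f ε := by
  choose N hN c hc using exists_pow_apply_eq f
  -- `S` bounds the return times of all residues at once; `S + 1` keeps the denominator positive.
  set S : ℝ := ∑ i ∈ Finset.Icc (1 : ℤ) n, (N i : ℝ) with hS
  have hS0 : 0 ≤ S := Finset.sum_nonneg fun i _ => Nat.cast_nonneg _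
  refine ⟨ε / (S + 1), by positivity, fun x hx i => ?_⟩
  change |x.pos (f.1 i) - x.pos i - (slope f i : ℝ)| ≤ ε
  have hp := redMod_eq n i
  set p := redMod n i
  have hpm : p ∈ Finset.Icc (1 : ℤ) n := redMod_mem n i
  have hpow : (f ^ N p).1 i = i + c p * n := by
    have := hc p
    rw [hp, affPerm_apply_add_mul] at this
    rw [hp]
    linarith
  refine (abs_sub_slope_le f x hx (hN p) hpow).trans ?_
  have h1 : (N p : ℝ) ≤ S := Finset.single_le_sum (f := fun i => (N i : ℝ))
    (fun i _ => Nat.cast_nonneg _) hpm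
  rw [← mul_div_assoc, div_le_iff₀ (by positivity)]
  nlinarith

/-! ### Dissipation -/

/-- The rate at which the energy `∑ (x(f(i)) - x(i))²` of the flow is dissipated. -/
noncomputable def dissipation {n : ℕ} (f : AffPerm n) (x : Config n) : ℝ :=
  ∑ i ∈ Finset.Icc (1 : ℤ) n,
    ((x.pos (f.1 (f.1 i)) - x.pos (f.1 i)) - (x.pos (f.1 i) - x.pos i)) ^ 2

theorem abs_le_of_dissipation {n : ℕ} [NeZero n] (f : AffPerm n) (x : Config n) {δ : ℝ}
    (hδ : 0 < δ) (h : dissipation f x < δ ^ 2) (i : ℤ) :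
    |(x.pos (f.1 (f.1 i)) - x.pos (f.1 i)) - (x.pos (f.1 i) - x.pos i)| ≤ δ := by
  refine forall_of_periodic (n := n) (P := fun i =>
    |(x.pos (f.1 (f.1 i)) - x.pos (f.1 i)) - (x.pos (f.1 i) - x.pos i)| ≤ δ)
    (fun i => ?_) (fun i hi => ?_) i
  · simp only [f.2 _, x.add_period]
    ring_nf
  · refine abs_le_of_sq_le_sq (le_trans ?_ h.le) hδ.le
    exact Finset.single_le_sum (f := fun i =>
      ((x.pos (f.1 (f.1 i)) - x.pos (f.1 i)) - (x.pos (f.1 i) - x.pos i)) ^ 2)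
      (fun i _ => sq_nonneg _) hi

theorem exists_dissipation_lt {n : ℕ} [NeZero n] (f : AffPerm n) {X : ℝ → Config n}
    (hX : ∀ i t, HasDerivAt (fun s => (X s).pos i) ((X t).pos (f.1 i) - (X t).pos i) t)
    {δ : ℝ} (hδ : 0 < δ) : ∃ t, 0 < t ∧ dissipation f (X t) < δ := by
  by_contra! H
  let V : ℝ → ℝ := fun t => ∑ i ∈ Finset.Icc (1 : ℤ) n, ((X t).pos (f.1 i) - (X t).pos i) ^ 2
  have hV0 : ∀ t, 0 ≤ V t := fun t => Finset.sum_nonneg fun i _ => sq_nonneg _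
  have hV : ∀ t, HasDerivAt V (-dissipation f (X t)) t := by
    intro t
    have h1 : HasDerivAt V (∑ i ∈ Finset.Icc (1 : ℤ) n, 2 * ((X t).pos (f.1 i) - (X t).pos i) *
        (((X t).pos (f.1 (f.1 i)) - (X t).pos (f.1 i)) - ((X t).pos (f.1 i) - (X t).pos i))) t := by
      refine HasDerivAt.fun_sum fun i _ => ?_
      simpa using ((hX (f.1 i) t).fun_sub (hX i t)).fun_pow 2
    convert h1 using 1
    -- With `v = x ∘ f - x`, one has `2 v (v ∘ f - v) = -(v ∘ f - v)² + (v ∘ f)² - v²`, and the last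
    -- two terms cancel over a period.
    have h2 := sum_comp_affPerm f (φ := fun i => ((X t).pos (f.1 i) - (X t).pos i) ^ 2)
      (fun i => by simp only [f.2 i, (X t).add_period]; ring)
    rw [← sub_eq_zero, ← Finset.sum_sub_distrib] at h2
    rw [dissipation, ← Finset.sum_neg_distrib, ← sub_eq_zero, ← Finset.sum_sub_distrib,
      ← neg_eq_zero, ← h2, ← Finset.sum_neg_distrib]
    refine Finset.sum_congr rfl fun i _ => ?_
    ring
  -- Dissipation at least `δ` during this time would cost `V 0 + δ`, more than the initial energy.
  have hB : 0 < V 0 / δ + 1 := by have := div_nonneg (hV0 0) hδ.le; linarith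
  obtain ⟨τ, hτ, he⟩ := exists_hasDerivAt_eq_slope V (fun t => -dissipation f (X t)) hB
    (fun t _ => (hV t).continuousAt.continuousWithinAt) fun t _ => hV t
  rw [sub_zero, eq_div_iff hB.ne'] at he
  have h1 := mul_le_mul_of_nonneg_right (H τ hτ.1) hB.le
  have h2 : δ * (V 0 / δ + 1) = V 0 + δ := by field_simp
  linarith [hV0 (V 0 / δ + 1)]

end ArrowDiagram

/-! ### Choice of the stopping time -/

theorem mainTheorem10 (n : ℕ) [NeZero n] (f : AffPerm n) (x : LSpace n) (hx : x.IsGeneric)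
    (ε : ℝ) (hε : 0 < ε) :
    ∃ (y : LSpace n) (hy : y.IsGeneric),
      y.IsStraight f ε ∧
      DiagTo f x hx y hy ∧
      ∃ (X : ℝ → Config n) (T : ℝ),
        IsFlowLine f X ∧ (X 0).toL = x ∧ 0 ≤ T ∧ (X T).toL = y ∧
        ∀ (s t : ℝ), 0 ≤ s → s ≤ t → t ≤ T →
          ∀ (hs : (X s).toL.IsGeneric) (ht : (X t).toL.IsGeneric),
            DiagTo f (X s).toL hs (X t).toL ht := by
  obtain ⟨x₀, rfl⟩ : ∃ x₀ : Config n, x₀.toL = x := Quotient.exists_rep x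
  obtain ⟨X, rfl, hX, hXa⟩ := exists_flow f x₀
  have hc : ∀ i, Continuous fun t => (X t).pos i := fun i =>
    continuousOn_univ.1 (hXa i).continuousOn
  obtain ⟨δ, hδ, hstr⟩ := exists_pos_isStraight f hε
  obtain ⟨B, hB, hdB⟩ := exists_dissipation_lt f hX (pow_pos hδ 2)
  have hfin := collisions_finite hXa hx (B + 1)
  have hopen : {t | dissipation f (X t) < δ ^ 2} ∈ nhds B := by
    refine (isOpen_lt (f := fun t => dissipation f (X t)) ?_ continuous_const).mem_nhds hdB
    unfold dissipation
    fun_prop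
  obtain ⟨η, hη, hball⟩ := Metric.mem_nhds_iff.1 hopen
  -- The bound `η` keeps the dissipation small at `T`; the bound `1` keeps `T` in the window `[0, B
  -- + 1]`, whose finitely many collision times are avoided.
  obtain ⟨T, hT, hTg⟩ := ((Set.Ioo_infinite (show B < B + min η 1 by
    linarith [lt_min hη one_pos])).sdiff hfin).nonempty
  have hT1 : T < B + 1 := hT.2.trans_le (by linarith [min_le_right η 1])
  have hT0 : 0 ≤ T := (hB.trans hT.1).le
  have hTd : dissipation f (X T) < δ ^ 2 := hball (by
    rw [Metric.mem_ball, Real.dist_eq, abs_of_pos (sub_pos.2 hT.1)]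
    linarith [hT.2, min_le_left η 1])
  have hg : (X T).toL.IsGeneric := by_contra fun h => hTg ⟨⟨hT0, hT1.le⟩, h⟩
  have hflow : ∀ (s t : ℝ), 0 ≤ s → s ≤ t → t ≤ T →
      ∀ (hs : (X s).toL.IsGeneric) (ht : (X t).toL.IsGeneric),
        DiagTo f (X s).toL hs (X t).toL ht := fun s t h0 hst htT hs ht =>
    diagTo_of_flow f hX hfin.toFinset hst hs ht fun τ hτ h =>
      hfin.mem_toFinset.2 ⟨⟨h0.trans hτ.1, (hτ.2.trans htT).trans hT1.le⟩, h⟩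
  exact ⟨(X T).toL, hg, hstr _ (abs_le_of_dissipation f _ hδ hTd),
    hflow 0 T le_rfl hT0 le_rfl hx hg, X, T, fun i t _ => (hX i t).hasDerivWithinAt,
    rfl, hT0, rfl, hflow⟩
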